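/- Let $G$ be a locally compact, Hausdorff, second countable group with left Haar measure $m$, and let $\mu$ be a Borel probability measure on $G$ which is spread-out, i.e. for some $n\ge 1$ the convolution power $\mu^{*n}$ is not singular with respect to $m$. Then there is a Borel probability measure $\mu'$ on $G$ which is absolutely continuous with respect to $m$, whose density $d\mu'/dm$ is ($m$-essentially) bounded, and such that the random walks $(G,\mu)$ and $(G,\mu')$ have the same Poisson boundary, $$\Gamma(G,\mu)=\Gamma(G,\mu').$$ Moreover, if the support of $\mu$ generates $G$ as a group, then so does the support of $\mu'$. Here the Poisson boundary is understood as follows. For $g\in G$ let $\mathbf P^\mu_g$ be the law on $G^{\mathbb N}$ of the path $x_0=g$, $x_n=gh_1h_2\cdots h_n$, where the increments $h_i$ are independent with law $\mu$. Let $S$ be the shift on $G^{\mathbb N}$. Two paths $x,y$ are equivalent if $S^kx=S^ly$ for some $k,l\ge 0$, and the Poisson $\sigma$-algebra $\mathcal A$ consists of the measurable subsets of $G^{\mathbb N}$ which are unions of equivalence classes. A standard Borel space $\Gamma$ with a (jointly) measurable $G$-action and a measure $\nu$ is the Poisson boundary of $(G,\mu)$ if there is a map $\mathrm{bnd}:G^{\mathbb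 N}\to\Gamma$ such that * $\mathrm{bnd}$ is $\mathcal A$-measurable, and every $A\in\mathcal A$ coincides with $\mathrm{bnd}^{-1}(B)$ for some measurable $B\subset\Gamma$, up to a set that is $\mathbf P^\mu_g$-null for every $g\in G$; * for all $k,g\in G$ one has $\mathrm{bnd}(kx_0,kx_1,\dots)=k\cdot\mathrm{bnd}(x)$ for $\mathbf P^\mu_g$-almost every path $x$; * $\nu$ is the image of $\mathbf P^\mu_e$ under $\mathrm{bnd}$. The equality $\Gamma(G,\mu)=\Gamma(G,\mu')$ means that one and the same standard Borel $G$-space $\Gamma$ with one and the same measure $\nu$ is the Poisson boundary of both $(G,\mu)$ and $(G,\mu')$. -/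

import Mathlib

open MeasureTheory Measure
open scoped NNReal

noncomputable section

namespace PoissonBoundary

universe u

variable {G : Type u} [Group G]

/-- The trajectory `x₀ = g`, `xₙ = g h₁ h₂ ⋯ hₙ` with starting point `g` and increments
`h₁ = h 0, h₂ = h 1, …`. -/
def walk (g : G) (h : ℕ → G) : ℕ → G
  | 0 => g
  | n + 1 => walk g h n * h n

/-- The time shift `S` on paths. -/
def shift (x : ℕ → G) : ℕ → G := fun n => x (n + 1)

/-- Two paths are equivalent if `S^m x = S^n y` for some `m`, `n`. -/
def PathEquiv (x y : ℕ → G) : Prop := ∃ m n : ℕ, shift^[m] x = shift^[n] y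

section Measurable

variable [MeasurableSpace G]

/-- The law `P_g` on path space of the random walk with step distribution `μ` started at `g`:
the image of the Bernoulli measure `μ^∞` on the increments. -/
def pathLaw (μ : Measure G) [IsProbabilityMeasure μ] (g : G) : Measure (ℕ → G) :=
  (Measure.infinitePi fun _ : ℕ => μ).map (walk g)

variable (G) in
/-- The Poisson σ-algebra: the measurable sets of paths that are unions of equivalence classes
of `PathEquiv`. -/
abbrev poissonSigma : MeasurableSpace (ℕ → G) where
  MeasurableSet' A := MeasurableSet A ∧ ∀ x y : ℕ → G, PathEquiv x y → (x ∈ A ↔ y ∈ A)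
  measurableSet_empty := ⟨MeasurableSet.empty, fun _ _ _ => Iff.rfl⟩
  measurableSet_compl A hA := ⟨hA.1.compl, fun x y h => not_congr (hA.2 x y h)⟩
  measurableSet_iUnion A hA := by
    refine ⟨MeasurableSet.iUnion fun i => (hA i).1, fun x y h => ?_⟩
    simp only [Set.mem_iUnion]
    exact exists_congr fun i => (hA i).2 x y h

/-- `bnd` is a boundary map of the random walk `(G, μ)` onto the `G`-space `(Γ, ν)`.
Statements modulo null sets of paths are modulo sets that are null for the walk from every
starting point, which is what lets `G` act on the quotient. -/
structure IsBoundaryMap (μ : Measure G) [IsProbabilityMeasure μ]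
    {Γ : Type u} [MeasurableSpace Γ] [MulAction G Γ] (ν : Measure Γ)
    (bnd : (ℕ → G) → Γ) : Prop where
  /-- `bnd⁻¹(σ(Γ))` is contained in the Poisson σ-algebra. -/
  measurable : Measurable[poissonSigma G] bnd
  /-- `bnd⁻¹(σ(Γ))` exhausts the Poisson σ-algebra modulo null sets. -/
  exhausts : ∀ A : Set (ℕ → G), MeasurableSet[poissonSigma G] A →
    ∃ B : Set Γ, MeasurableSet B ∧ ∀ g : G, A =ᵐ[pathLaw μ g] bnd ⁻¹' B
  /-- The action on `Γ` is the one induced by left translation of paths. -/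
  equivariant : ∀ k g : G, ∀ᵐ x ∂(pathLaw μ g), bnd (fun n => k * x n) = k • bnd x
  /-- `ν` is the harmonic measure: the image of the law of the walk started at the identity. -/
  harmonic : (pathLaw μ 1).map bnd = ν

/-- The standard Borel `G`-space `Γ` with the measure `ν` is (a model of) the Poisson boundary
of `(G, μ)`, that is, the quotient of the path space by the Poisson σ-algebra. -/
def IsPoissonBoundary (μ : Measure G) [IsProbabilityMeasure μ]
    (Γ : Type u) [MeasurableSpace Γ] [StandardBorelSpace Γ] [MulAction G Γ]
    [MeasurableSMul₂ G Γ] (ν : Measure Γ) : Prop :=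
  ∃ bnd : (ℕ → G) → Γ, IsBoundaryMap μ ν bnd

/-- `Γ(G, μ) = Γ(G, μ')`: one and the same Borel `G`-space with one and the same measure is the
Poisson boundary of both random walks. -/
def SamePoissonBoundary (μ μ' : Measure G) [IsProbabilityMeasure μ]
    [IsProbabilityMeasure μ'] : Prop :=
  ∃ (Γ : Type u) (_ : MeasurableSpace Γ) (_ : StandardBorelSpace Γ) (_ : MulAction G Γ)
    (_ : MeasurableSMul₂ G Γ) (ν : Measure Γ),
    IsPoissonBoundary μ Γ ν ∧ IsPoissonBoundary μ' Γ ν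

/-- Convolution powers, `convPow μ n = μ^{*n}`. -/
def convPow (μ : Measure G) : ℕ → Measure G
  | 0 => Measure.dirac 1
  | n + 1 => (convPow μ n).mconv μ

/-- `μ` is spread-out (with respect to the Haar measure `m`) if some convolution power `μ^{*n}`,
`n ≥ 1`, is not singular with respect to `m`. -/
def IsSpreadOut (m μ : Measure G) : Prop :=
  ∃ n : ℕ, 1 ≤ n ∧ ¬ (convPow μ n).MutuallySingular m

end Measurable

end PoissonBoundary

end

/-!
Two facts carry the proof: `μ` and a suitable `μ'` with bounded density have the same bounded
harmonic functions, and the Poisson boundary can be built from these functions alone.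

*The measure.* Write a step distribution as `κ = β + σ` with `β ≠ 0` and observe the walk only
when an increment comes from `β`. The new step distribution `∑ₖ σ^{*k} * β` (`stopped`) satisfies
`κ' = β + σ * κ'`, from which it has the same bounded harmonic functions as `κ`
(`isHarmonic_stopped_iff`), and its support generates a group containing the support of `κ`. The
choice `β = σ = μ/2` replaces `μ` by `∑ₙ 2⁻ⁿ μ^{*n}`, which is not singular because `μ` is
spread-out. Taking for `β` the absolutely continuous part of the latter with its density cut off
at `1`, the resulting `μ'` has bounded density, since convolution from the left by a measure of
mass `c` multiplies the bound of a density with respect to left Haar measure by at most `c`.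

*The boundary.* For harmonic `f` let `lim f(x)` be the limit of `f` along the path `x` (a limit
superior, so that it makes sense for all paths). The points of the boundary are families of
continuous functions on `G`, namely `k ↦ ∫_C lim f(u⁻¹ k x) dm(u)` for countably many pairs
`(f, C)`, and `G` acts by right translation of the argument. Integration over `u` makes these
functions continuous in `k`, so that `C(G, ℝ)^ι` is a Polish space with a continuous action. The
map from paths to families is exactly equivariant and shift invariant, and it is the same map for
both walks.

*Harmonic measure.* The coordinates of the boundary map are the boundary values of harmonic
functions. If `f` is harmonic, then `g ↦ 𝔼_g exp (s lim f)` is the least harmonic majorant of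
`exp (s f)`, hence the same for `μ` and `μ'`. So the law of `lim f` is the same for both walks, and
the Cramér–Wold device gives equality of the harmonic measures (`map_boundaryMap_eq`).

*Exhaustion.* For `A` in the Poisson σ-algebra the harmonic function `f(g) = P_g(A)` has boundary
value `1_A` by Lévy's zero-one law. For each of the two walks the functions `f` include those of a
sequence of sets `A` that is dense in the Poisson σ-algebra; the sets `C` form an algebra
generating the Borel sets of an open set of finite measure. Then the integrals
`∫_C 1_A(u⁻¹ x) dm(u)` determine the function `u ↦ 1_A(u⁻¹ x)` almost everywhere, measurably in the
path, and equivariance gives back `A` itself (`exists_preimage_boundaryMap_ae_eq`). Sets of the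
Poisson σ-algebra that are null for almost every starting point are null for all of them, because a
`μ'`-harmonic function that vanishes almost everywhere is zero.
-/

namespace PoissonBoundary

open Filter Topology ProbabilityTheory
open scoped ENNReal

/-! ### Harmonic functions and stopped step distributions -/

section

variable {G : Type*} [Group G] [MeasurableSpace G]

/-- Bounded measurable functions with the mean value property `f g = ∫ f (g h) dμ(h)`, i.e. the
bounded harmonic functions of the random walk `(G, μ)`. -/
structure IsHarmonic (μ : Measure G) (f : G → ℝ) : Prop where
  measurable : Measurable f
  bounded : ∃ C, ∀ g, |f g| ≤ C
  mean : ∀ g, ∫ y, f (g * y) ∂μ = f g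

theorem integrable_of_measurable_of_bounded {α : Type*} [MeasurableSpace α] {P : Measure α}
    [IsFiniteMeasure P] {f : α → ℝ} (hf : Measurable f) {C : ℝ} (hC : ∀ x, |f x| ≤ C) :
    Integrable f P :=
  Integrable.of_bound hf.aestronglyMeasurable C (ae_of_all _ hC)

instance isFiniteMeasure_convPow (σ : Measure G) [IsFiniteMeasure σ] (n : ℕ) :
    IsFiniteMeasure (convPow σ n) := by
  induction n with
  | zero => simp only [convPow]; infer_instance
  | succ n ih => simp only [convPow]; infer_instance

/-- For `κ = β + σ` this is `∑ₖ σ^{*k} * β`, the step distribution of the walk `(G, κ)` observed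
at the first time an increment is drawn from the part `β`. -/
noncomputable def stopped (β σ : Measure G) : Measure G :=
  Measure.sum fun k : ℕ => (convPow σ k).mconv β

/-- A bounded function equal to its own averages against a measure of mass less than one
vanishes. -/
theorem eq_zero_of_eq_integral {σ : Measure G} [IsFiniteMeasure σ] (hσ : σ Set.univ < 1)
    {q : G → ℝ} {C : ℝ} (hC : ∀ g, |q g| ≤ C) (hq : ∀ g, q g = ∫ x, q (g * x) ∂σ) (g : G) :
    q g = 0 := by
  have key : ∀ n : ℕ, ∀ g, |q g| ≤ C * σ.real Set.univ ^ n := by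
    intro n
    induction n with
    | zero => simpa using hC
    | succ n ih =>
      intro g
      rw [hq g, ← Real.norm_eq_abs]
      calc _ ≤ C * σ.real Set.univ ^ n * σ.real Set.univ :=
            norm_integral_le_of_norm_le_const (ae_of_all _ fun x => ih (g * x))
        _ = _ := by ring
  have hs : σ.real Set.univ < 1 := by
    have := (ENNReal.toReal_lt_toReal (measure_ne_top σ _) ENNReal.one_ne_top).2 hσ
    simpa [Measure.real] using this
  have hlim := (tendsto_pow_atTop_nhds_zero_of_lt_one measureReal_nonneg hs).const_mul C
  rw [mul_zero] at hlim
  exact abs_nonpos_iff.1 (ge_of_tendsto' hlim fun n => key n g)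

theorem apply_univ_lt_one {α : Type*} [MeasurableSpace α] {β σ : Measure α} [IsFiniteMeasure σ]
    [IsProbabilityMeasure (β + σ)] (hβ : β ≠ 0) : σ Set.univ < 1 := by
  have h : β Set.univ + σ Set.univ = 1 := by
    rw [← Measure.add_apply]; exact measure_univ
  rw [← h, add_comm]
  exact ENNReal.lt_add_right (measure_ne_top _ _) (by simpa using hβ)

theorem absolutelyContinuous_and_rnDeriv_le {α : Type*} [MeasurableSpace α] {m ν : Measure α}
    [SigmaFinite m] {C : ℝ≥0} (h : ν ≤ C • m) : ν ≪ m ∧ ∀ᵐ g ∂m, ν.rnDeriv m g ≤ C := by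
  refine ⟨h.absolutelyContinuous.trans (smul_absolutelyContinuous (c := C)), ?_⟩
  refine ae_le_of_forall_setLIntegral_le_of_sigmaFinite (measurable_rnDeriv _ _)
    fun s hs _ => ?_
  calc _ ≤ ν s := setLIntegral_rnDeriv_le s
    _ ≤ (C • m) s := h s
    _ = _ := by rw [setLIntegral_const, Measure.smul_apply, ENNReal.smul_def, smul_eq_mul]

variable [MeasurableMul₂ G]

theorem convPow_succ_left (σ : Measure G) [IsFiniteMeasure σ] (n : ℕ) :
    convPow σ (n + 1) = σ.mconv (convPow σ n) := by
  induction n with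
  | zero => simp [convPow]
  | succ n ih =>
    change (convPow σ (n + 1)).mconv σ = σ.mconv ((convPow σ n).mconv σ)
    rw [ih, mconv_assoc]

theorem convPow_smul (μ : Measure G) [IsFiniteMeasure μ] (c : ℝ≥0) (n : ℕ) :
    convPow ((c : ℝ≥0∞) • μ) n = (c : ℝ≥0∞) ^ n • convPow μ n := by
  induction n with
  | zero => simp [convPow]
  | succ n ih =>
    have : IsFiniteMeasure ((c : ℝ≥0∞) • μ) := inferInstanceAs (IsFiniteMeasure (c • μ))
    simp only [convPow]
    rw [ih, mconv_smul_left]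
    refine Measure.ext_of_lintegral _ fun f hf => ?_
    rw [lintegral_smul_measure, lintegral_mconv hf, lintegral_smul_measure, lintegral_mconv hf]
    simp only [lintegral_smul_measure, smul_eq_mul]
    rw [lintegral_const_mul' _ _ ENNReal.coe_ne_top, ← mul_assoc, pow_succ]

theorem mconv_apply_univ (μ ν : Measure G) [SFinite ν] :
    (μ.mconv ν) Set.univ = μ Set.univ * ν Set.univ := by
  rw [← lintegral_one, lintegral_mconv measurable_const]
  simp [mul_comm]

/-- The first increment is either from `β`, when the walk is stopped, or from `σ`, when the
procedure starts afresh. -/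
theorem stopped_eq (β σ : Measure G) [IsFiniteMeasure β] [IsFiniteMeasure σ] :
    stopped β σ = β + σ.mconv (stopped β σ) := by
  have : SFinite (stopped β σ) := by unfold stopped; infer_instance
  refine Measure.ext_of_lintegral _ fun f hf => ?_
  rw [lintegral_add_measure, lintegral_mconv hf]
  simp only [stopped, lintegral_sum_measure]
  rw [lintegral_tsum fun k => ?_, tsum_eq_zero_add' ENNReal.summable]
  · congr 1
    · rw [convPow, dirac_one_mconv]
    · refine tsum_congr fun k => ?_
      rw [convPow_succ_left, mconv_assoc, lintegral_mconv hf]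
  · have hm : Measurable fun p : G × G => f (p.1 * p.2) := hf.comp measurable_mul
    exact hm.lintegral_prod_right'.aemeasurable

variable {β σ : Measure G} [IsFiniteMeasure β] [IsFiniteMeasure σ]

theorem convPow_apply_univ (n : ℕ) : convPow σ n Set.univ = σ Set.univ ^ n := by
  induction n with
  | zero => simp [convPow]
  | succ n ih => rw [convPow, mconv_apply_univ, ih, pow_succ]

theorem isProbabilityMeasure_stopped [IsProbabilityMeasure (β + σ)] (hβ : β ≠ 0) :
    IsProbabilityMeasure (stopped β σ) := by
  have h : β Set.univ + σ Set.univ = 1 := by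
    rw [← Measure.add_apply]; exact measure_univ
  have hβ' : β Set.univ = 1 - σ Set.univ :=
    ENNReal.eq_sub_of_add_eq (measure_ne_top _ _) h
  refine ⟨?_⟩
  rw [stopped, Measure.sum_apply _ MeasurableSet.univ]
  simp only [mconv_apply_univ, convPow_apply_univ]
  rw [ENNReal.tsum_mul_right, ENNReal.tsum_geometric, ← hβ',
    ENNReal.inv_mul_cancel (by simpa using hβ) (measure_ne_top _ _)]

theorem integral_stopped [IsProbabilityMeasure (β + σ)] (hβ : β ≠ 0) {f : G → ℝ}
    (hf : Measurable f) {C : ℝ} (hC : ∀ g, |f g| ≤ C) :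
    ∫ y, f y ∂(stopped β σ) = ∫ y, f y ∂β + ∫ x, ∫ y, f (x * y) ∂(stopped β σ) ∂σ := by
  have := isProbabilityMeasure_stopped (σ := σ) hβ
  conv_lhs => rw [stopped_eq]
  have h1 : Integrable f β := integrable_of_measurable_of_bounded hf hC
  rw [integral_add_measure h1
    (integrable_of_measurable_of_bounded hf hC),
    integral_mconv (integrable_of_measurable_of_bounded hf hC)]

/-- Stopping does not change the bounded harmonic functions. -/
theorem isHarmonic_stopped_iff [IsProbabilityMeasure (β + σ)] (hβ : β ≠ 0) {f : G → ℝ} :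
    IsHarmonic (stopped β σ) f ↔ IsHarmonic (β + σ) f := by
  have hP := isProbabilityMeasure_stopped (σ := σ) hβ
  suffices H : Measurable f → (∃ C, ∀ g, |f g| ≤ C) →
      ((∀ g, ∫ y, f (g * y) ∂(stopped β σ) = f g) ↔ ∀ g, ∫ y, f (g * y) ∂(β + σ) = f g) from
    ⟨fun h => ⟨h.1, h.2, (H h.1 h.2).1 h.3⟩, fun h => ⟨h.1, h.2, (H h.1 h.2).2 h.3⟩⟩
  rintro hf ⟨C, hC⟩
  have hfg : ∀ g, Measurable fun y => f (g * y) := fun g => hf.comp (measurable_const_mul g)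
  have hadd : ∀ g, ∫ y, f (g * y) ∂(β + σ) = ∫ y, f (g * y) ∂β + ∫ y, f (g * y) ∂σ := fun g =>
    integral_add_measure (integrable_of_measurable_of_bounded (hfg g) fun y => hC _)
      (integrable_of_measurable_of_bounded (hfg g) fun y => hC _)
  have hst : ∀ g, ∫ y, f (g * y) ∂(stopped β σ) =
      ∫ y, f (g * y) ∂β + ∫ x, ∫ y, f (g * x * y) ∂(stopped β σ) ∂σ := fun g => by
    simpa only [mul_assoc] using integral_stopped hβ (hfg g) (fun y => hC _)
  constructor
  · intro h g
    rw [hadd, ← h g, hst]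
    simp only [h]
  · intro h
    set F : G → ℝ := fun g => ∫ y, f (g * y) ∂(stopped β σ) with hF
    have hFC : ∀ g, |F g| ≤ C := fun g => by
      rw [← Real.norm_eq_abs]
      simpa using norm_integral_le_of_norm_le_const (μ := stopped β σ) (f := fun y => f (g * y))
        (C := C) (ae_of_all _ fun y => hC (g * y))
    have hFm : Measurable F :=
      (StronglyMeasurable.integral_prod_right (f := fun g y => f (g * y)) (ν := stopped β σ)
        (hf.comp measurable_mul).stronglyMeasurable).measurable
    -- by `stopped_eq` the defect `F - f` is equal to its own average against `σ`
    have key : ∀ g, F g - f g = 0 := by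
      refine eq_zero_of_eq_integral (σ := σ) (q := fun g => F g - f g) (C := C + C)
        (apply_univ_lt_one hβ) (fun g => ?_) fun g => ?_
      · exact (abs_sub _ _).trans (add_le_add (hFC g) (hC g))
      · have hFg : Measurable fun y => F (g * y) := hFm.comp (measurable_const_mul g)
        rw [integral_sub (integrable_of_measurable_of_bounded hFg fun y => hFC _)
          (integrable_of_measurable_of_bounded (hfg g) fun y => hC _)]
        have h1 := h g
        rw [hadd] at h1
        have h2 : F g = _ := hst g
        change F g - f g = ∫ x, F (g * x) ∂σ - _
        simp only [hF] at h2 ⊢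
        linarith
    exact fun g => sub_eq_zero.1 (key g)

/-- Convolution from the left multiplies a bound of the density with respect to a left invariant
measure by at most the mass of the convolving measure. -/
theorem mconv_le_smul {σ m : Measure G} [SFinite m] [m.IsMulLeftInvariant] (hβ : β ≤ m) :
    σ.mconv β ≤ σ Set.univ • m := by
  refine Measure.le_iff.2 fun s hs => ?_
  rw [← lintegral_indicator_one hs, lintegral_mconv (by measurability)]
  calc _ ≤ ∫⁻ x, ∫⁻ y, s.indicator 1 (x * y) ∂m ∂σ :=
        lintegral_mono fun x => lintegral_mono' hβ le_rfl
    _ = ∫⁻ _, m s ∂σ := by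
        congr 1; ext x
        rw [lintegral_mul_left_eq_self (fun y => s.indicator 1 y) x, lintegral_indicator_one hs]
    _ = _ := by simp [mul_comm]

theorem stopped_le_smul {m : Measure G} [SFinite m] [m.IsMulLeftInvariant] (hβ : β ≤ m)
    (hσ : σ Set.univ < 1) : ∃ C : ℝ≥0, stopped β σ ≤ C • m := by
  have hne : (1 - σ Set.univ)⁻¹ ≠ ∞ := ENNReal.inv_ne_top.2 (tsub_pos_of_lt hσ).ne'
  refine ⟨(1 - σ Set.univ)⁻¹.toNNReal, Measure.le_iff.2 fun s hs => ?_⟩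
  rw [stopped, Measure.sum_apply _ hs, Measure.smul_apply, ENNReal.smul_def,
    ENNReal.coe_toNNReal hne, smul_eq_mul, ← ENNReal.tsum_geometric, ← ENNReal.tsum_mul_right]
  refine ENNReal.tsum_le_tsum fun k => ?_
  rw [← convPow_apply_univ]
  exact mconv_le_smul hβ s

section Support

variable [TopologicalSpace G] [IsTopologicalGroup G]

theorem mul_mem_support_mconv {μ ν : Measure G} [SFinite μ] [SFinite ν] {a b : G}
    (ha : a ∈ μ.support) (hb : b ∈ ν.support) : a * b ∈ (μ.mconv ν).support := by
  rw [mem_support_iff_forall] at ha hb ⊢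
  intro U hU
  obtain ⟨V, hV, W, hW, hVW⟩ := mem_nhds_prod_iff.1 (continuous_mul.tendsto (a, b) hU)
  calc 0 < μ V * ν W := ENNReal.mul_pos (ha V hV).ne' (hb W hW).ne'
    _ = (μ.prod ν) (V ×ˢ W) := (prod_prod V W).symm
    _ ≤ (μ.prod ν) ((fun x : G × G => x.1 * x.2) ⁻¹' U) := measure_mono hVW
    _ ≤ _ := le_map_apply measurable_mul.aemeasurable U

variable [SecondCountableTopology G]

/-- The increments of the original walk are products of increments of the stopped walk and their
inverses: if `s` is an increment from `σ` and `b` one from `β`, both `s b` and `b` are increments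
of the stopped walk. -/
theorem support_subset_closure_stopped (hβ : β ≠ 0) :
    (β + σ).support ⊆ Subgroup.closure (stopped β σ).support := by
  have hsf : SFinite (stopped β σ) := by unfold stopped; infer_instance
  have hsub : β.support ⊆ (stopped β σ).support :=
    support_mono (by rw [stopped_eq]; exact Measure.le_add_right le_rfl)
  rw [support_add]
  refine Set.union_subset (hsub.trans Subgroup.subset_closure) fun s hs => ?_
  obtain ⟨b, hb⟩ := nonempty_support hβ
  have hsb : s * b ∈ (stopped β σ).support := by
    have : (σ.mconv (stopped β σ)).support ⊆ (stopped β σ).support :=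
      support_mono (by conv_rhs => rw [stopped_eq]
                       exact Measure.le_add_left le_rfl)
    exact this (mul_mem_support_mconv hs (hsub hb))
  have := Subgroup.mul_mem _ (Subgroup.subset_closure hsb)
    (Subgroup.inv_mem _ (Subgroup.subset_closure (hsub hb)))
  simpa using this

/-- A spread-out random walk has the same bounded harmonic functions as a random walk whose step
distribution has bounded density. First `μ` is replaced by `∑ₙ 2⁻ⁿ μ^{*n}`, which is itself not
singular, and then the latter is stopped at its absolutely continuous part. -/
theorem exists_bounded_density_same_harmonic {m : Measure G} [SigmaFinite m]
    [m.IsMulLeftInvariant] {μ : Measure G} [IsProbabilityMeasure μ] (hμ : IsSpreadOut m μ) :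
    ∃ (μ' : Measure G) (_ : IsProbabilityMeasure μ'), μ' ≪ m ∧
      (∃ C : ℝ≥0, ∀ᵐ g ∂m, μ'.rnDeriv m g ≤ C) ∧
      μ.support ⊆ Subgroup.closure μ'.support ∧ ∀ f, IsHarmonic μ' f ↔ IsHarmonic μ f := by
  -- `stopped (μ/2) (μ/2)` is `∑ₙ 2⁻ⁿ μ^{*n}`, summed over `n ≥ 1`
  set c : ℝ≥0 := 2⁻¹ with hc
  have hcc : c + c = 1 := by rw [hc, ← two_mul, mul_inv_cancel₀ two_ne_zero]
  have hc0 : c ≠ 0 := by simp [hc]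
  set β : Measure G := (c : ℝ≥0∞) • μ with hβdef
  have : IsFiniteMeasure β := inferInstanceAs (IsFiniteMeasure (c • μ))
  have hβ : β ≠ 0 := by
    intro h
    have := congrArg (fun ν : Measure G => ν Set.univ) h
    simp [hβdef, hc0] at this
  have hββ : β + β = μ := by
    rw [hβdef, ← add_smul, ← ENNReal.coe_add, hcc, ENNReal.coe_one, one_smul]
  have : IsProbabilityMeasure (β + β) := hββ ▸ inferInstance
  set κ := stopped β β with hκ
  have : IsProbabilityMeasure κ := isProbabilityMeasure_stopped hβ
  have hsing : ¬ κ ⟂ₘ m := by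
    obtain ⟨n, hn, hns⟩ := hμ
    obtain ⟨n, rfl⟩ := Nat.exists_eq_add_of_le' hn
    intro h
    refine hns (h.mono_ac (AbsolutelyContinuous.mk fun s _ hs0 => ?_) AbsolutelyContinuous.rfl)
    have h1 : convPow β (n + 1) ≤ κ := le_sum (fun k => (convPow β k).mconv β) n
    have h2 := le_antisymm ((h1 s).trans hs0.le) zero_le
    rw [convPow_smul, Measure.smul_apply, smul_eq_mul, mul_eq_zero] at h2
    exact h2.resolve_left (pow_ne_zero _ (ENNReal.coe_ne_zero.2 hc0))
  -- the density is cut off at `1`, so that `α ≤ m`; it remains nonzero as `κ` is not singular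
  set α : Measure G := m.withDensity fun g => min (κ.rnDeriv m g) 1 with hα
  have hακ : α ≤ κ :=
    (withDensity_mono (ae_of_all _ fun g => min_le_left _ _)).trans (withDensity_rnDeriv_le κ m)
  have hαm : α ≤ m := by
    conv_rhs => rw [← withDensity_one (μ := m)]
    exact withDensity_mono (ae_of_all _ fun g => min_le_right _ _)
  have hα0 : α ≠ 0 := by
    intro h
    refine hsing ((rnDeriv_eq_zero κ m).1 ?_)
    have := (withDensity_eq_zero_iff
      ((measurable_rnDeriv κ m).min measurable_const).aemeasurable).1 h
    filter_upwards [this] with g hg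
    simpa using hg
  have : IsFiniteMeasure α := isFiniteMeasure_of_le κ hακ
  set σ := κ - α with hσ
  have hsum : α + σ = κ := by rw [add_comm]; exact sub_add_cancel_of_le hακ
  have : IsFiniteMeasure σ :=
    isFiniteMeasure_of_le κ (by rw [← hsum]; exact Measure.le_add_left le_rfl)
  have : IsProbabilityMeasure (α + σ) := hsum ▸ inferInstance
  have hP : IsProbabilityMeasure (stopped α σ) := isProbabilityMeasure_stopped hα0
  obtain ⟨C, hC⟩ := stopped_le_smul (σ := σ) hαm (apply_univ_lt_one hα0)
  obtain ⟨hac, hbd⟩ := absolutelyContinuous_and_rnDeriv_le hC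
  refine ⟨stopped α σ, hP, hac, ⟨C, hbd⟩, ?_, fun f => ?_⟩
  · have h1 : μ.support ⊆ Subgroup.closure κ.support := by
      conv_lhs => rw [← hββ]
      exact support_subset_closure_stopped hβ
    have h2 : κ.support ⊆ Subgroup.closure (stopped α σ).support := by
      conv_lhs => rw [← hsum]
      exact support_subset_closure_stopped hα0
    exact h1.trans ((Subgroup.closure_le _).2 h2)
  · rw [isHarmonic_stopped_iff hα0, hsum, hκ, isHarmonic_stopped_iff hβ, hββ]

end Support

end

/-! ### Harmonic functions along paths -/

section Walk

variable {G : Type*}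

theorem pathEquiv_shift (x : ℕ → G) : PathEquiv x (shift x) := ⟨1, 0, rfl⟩

theorem shift_iterate (x : ℕ → G) (n m : ℕ) : shift^[n] x m = x (n + m) := by
  induction n generalizing x with
  | zero => simp
  | succ n ih => rw [Function.iterate_succ_apply, ih, shift]; congr 1; ring

theorem apply_shift_iterate {α : Type*} {Ψ : (ℕ → G) → α} (hΨ : ∀ x, Ψ (shift x) = Ψ x) (x : ℕ → G)
    (n : ℕ) : Ψ (shift^[n] x) = Ψ x := by
  induction n with
  | zero => rfl
  | succ n ih => rw [Function.iterate_succ_apply', hΨ, ih]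

theorem apply_tail {α : Type*} {Ψ : (ℕ → G) → α} (hΨ : ∀ x, Ψ (shift x) = Ψ x) (x : ℕ → G)
    (n : ℕ) : Ψ (fun m => x (n + m)) = Ψ x := by
  have : (fun m => x (n + m)) = shift^[n] x := funext fun m => (shift_iterate x n m).symm
  rw [this, apply_shift_iterate hΨ]

theorem eq_of_pathEquiv {α : Type*} {Ψ : (ℕ → G) → α} (hΨ : ∀ x, Ψ (shift x) = Ψ x)
    {x y : ℕ → G} (h : PathEquiv x y) : Ψ x = Ψ y := by
  obtain ⟨a, b, hab⟩ := h
  rw [← apply_shift_iterate hΨ x a, hab, apply_shift_iterate hΨ]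

/-- The limit of `f` along a path, taken as a limit superior so that it is defined for all paths. -/
noncomputable def pathLim (f : G → ℝ) (x : ℕ → G) : ℝ := limsup (fun n => f (x n)) atTop

theorem pathLim_shift (f : G → ℝ) (x : ℕ → G) : pathLim f (shift x) = pathLim f x :=
  limsup_nat_add (fun n => f (x n)) 1

theorem pathLim_mem_Icc {f : G → ℝ} {a b : ℝ} (hf : ∀ g, f g ∈ Set.Icc a b) (x : ℕ → G) :
    pathLim f x ∈ Set.Icc a b := by
  have hb : IsBoundedUnder (· ≥ ·) atTop fun n => f (x n) :=
    isBoundedUnder_of ⟨a, fun n => (hf _).1⟩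
  have hb' : IsBoundedUnder (· ≤ ·) atTop fun n => f (x n) :=
    isBoundedUnder_of ⟨b, fun n => (hf _).2⟩
  exact ⟨le_limsup_of_frequently_le (Frequently.of_forall fun n => (hf _).1) hb',
    limsup_le_of_le hb.isCoboundedUnder_flip (Eventually.of_forall fun n => (hf _).2)⟩

theorem abs_pathLim_le {f : G → ℝ} {C : ℝ} (hC : ∀ g, |f g| ≤ C) (x : ℕ → G) :
    |pathLim f x| ≤ C :=
  abs_le.2 (pathLim_mem_Icc (fun g => abs_le.1 (hC g)) x)

variable [Group G]

theorem mul_walk (k g : G) (h : ℕ → G) : (fun n => k * walk g h n) = walk (k * g) h := by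
  funext n
  induction n with
  | zero => rfl
  | succ n ih => simp only [walk, ← ih, mul_assoc]

theorem walk_add (g : G) (h : ℕ → G) (n : ℕ) :
    (fun m => walk g h (n + m)) = walk (walk g h n) fun i => h (n + i) := by
  funext m
  induction m with
  | zero => rfl
  | succ m ih => rw [← add_assoc]; simp only [walk, ih]

theorem walk_congr (g : G) {h h' : ℕ → G} {n : ℕ} (H : ∀ i < n, h i = h' i) :
    walk g h n = walk g h' n := by
  induction n with
  | zero => rfl
  | succ n ih => simp only [walk, ih fun i hi => H i (hi.trans n.lt_succ_self), H n n.lt_succ_self]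

end Walk

section CondExp

/-- Conditioning on one of two independent variables integrates out the other one. -/
theorem condExp_comap_of_indepFun {Ω α β : Type*} [MeasurableSpace Ω] [MeasurableSpace α]
    [MeasurableSpace β] {P : Measure Ω} [IsProbabilityMeasure P] {U : Ω → α} {V : Ω → β}
    (hU : Measurable U) (hV : Measurable V) (hUV : IndepFun U V P) {Φ : α × β → ℝ}
    (hΦ : Measurable Φ) {C : ℝ} (hC : ∀ p, |Φ p| ≤ C) :
    P[fun ω => Φ (U ω, V ω) | MeasurableSpace.comap U inferInstance] =ᵐ[P]
      fun ω => ∫ v, Φ (U ω, v) ∂(P.map V) := by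
  have : IsProbabilityMeasure (P.map U) := isProbabilityMeasure_map hU.aemeasurable
  have : IsProbabilityMeasure (P.map V) := isProbabilityMeasure_map hV.aemeasurable
  have hsm : Measurable fun u => ∫ v, Φ (u, v) ∂(P.map V) :=
    (StronglyMeasurable.integral_prod_right (f := fun u v => Φ (u, v)) (ν := P.map V)
      hΦ.stronglyMeasurable).measurable
  have hbd : ∀ u, |∫ v, Φ (u, v) ∂(P.map V)| ≤ C := fun u => by
    rw [← Real.norm_eq_abs]
    simpa using norm_integral_le_of_norm_le_const (μ := P.map V) (f := fun v => Φ (u, v))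
      (C := C) (ae_of_all _ fun v => hC (u, v))
  have hint : Integrable (fun ω => ∫ v, Φ (U ω, v) ∂(P.map V)) P :=
    integrable_of_measurable_of_bounded (hsm.comp hU) fun ω => hbd _
  refine (ae_eq_condExp_of_forall_setIntegral_eq hU.comap_le
    (integrable_of_measurable_of_bounded (hΦ.comp (hU.prodMk hV)) fun ω => hC _)
    (fun s _ _ => hint.integrableOn) ?_ ?_).symm
  · rintro _ ⟨s, hs, rfl⟩ -
    have hΦs : Measurable fun p : α × β => (s.indicator 1 p.1 : ℝ) * Φ p :=
      ((measurable_one.indicator hs).comp measurable_fst).mul hΦ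
    have hΦsC : ∀ p : α × β, |(s.indicator 1 p.1 : ℝ) * Φ p| ≤ C := fun p => by
      rw [abs_mul]
      refine (mul_le_of_le_one_left (abs_nonneg _) ?_).trans (hC p)
      by_cases hp : p.1 ∈ s <;> simp [hp]
    have hind : ∀ F : Ω → ℝ,
        ∫ ω in U ⁻¹' s, F ω ∂P = ∫ ω, (s.indicator 1 (U ω) : ℝ) * F ω ∂P := fun F => by
      rw [← integral_indicator (hU hs)]
      congr 1; ext ω
      by_cases hω : U ω ∈ s <;> simp [Set.indicator, hω]
    rw [hind, hind]
    calc _ = ∫ u, ∫ v, (s.indicator 1 u : ℝ) * Φ (u, v) ∂(P.map V) ∂(P.map U) := by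
          simp_rw [integral_const_mul]
          rw [integral_map hU.aemeasurable]
          exact ((measurable_one.indicator hs).mul hsm).aestronglyMeasurable
      _ = ∫ p, (s.indicator 1 p.1 : ℝ) * Φ p ∂((P.map U).prod (P.map V)) :=
          (integral_prod _ (integrable_of_measurable_of_bounded hΦs hΦsC)).symm
      _ = ∫ p, (s.indicator 1 p.1 : ℝ) * Φ p ∂(P.map fun ω => (U ω, V ω)) := by
          rw [(indepFun_iff_map_prod_eq_prod_map_map hU.aemeasurable hV.aemeasurable).1 hUV]
      _ = _ := integral_map (hU.prodMk hV).aemeasurable hΦs.aestronglyMeasurable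
  · exact (hsm.comp (comap_measurable U)).aestronglyMeasurable

end CondExp

section Increments

variable {G : Type*} [MeasurableSpace G] (μ : Measure G) [IsProbabilityMeasure μ]

theorem indepFun_initial_tail (n : ℕ) :
    IndepFun (fun (ω : ℕ → G) (i : Fin n) => ω i) (fun (ω : ℕ → G) i => ω (n + i))
      (Measure.infinitePi fun _ : ℕ => μ) := by
  have hind : iIndepFun (fun (i : ℕ) (ω : ℕ → G) => ω i) (Measure.infinitePi fun _ : ℕ => μ) :=
    iIndepFun_infinitePi (X := fun _ x => x) (fun _ => measurable_id)
  have h := indep_iSup_of_disjoint (S := Set.Iio n) (T := Set.Ici n)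
    (fun i => (measurable_pi_apply i).comap_le) hind.iIndep
    (Set.disjoint_left.2 fun i hi hi' => absurd (Set.mem_Iio.1 hi) (not_lt.2 hi'))
  refine indep_of_indep_of_le_left (indep_of_indep_of_le_right h ?_) ?_
  · simp only [MeasurableSpace.pi, MeasurableSpace.comap_iSup, MeasurableSpace.comap_comp]
    exact iSup_le fun i =>
      le_iSup₂_of_le (n + i) (Set.mem_Ici.2 (Nat.le_add_right n i)) le_rfl
  · simp only [MeasurableSpace.pi, MeasurableSpace.comap_iSup, MeasurableSpace.comap_comp]
    exact iSup_le fun i => le_iSup₂_of_le (i : ℕ) i.2 le_rfl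

theorem map_tail (n : ℕ) :
    (Measure.infinitePi fun _ : ℕ => μ).map (fun (ω : ℕ → G) i => ω (n + i)) =
      Measure.infinitePi fun _ : ℕ => μ := by
  have hind : iIndepFun (fun (i : ℕ) (ω : ℕ → G) => ω i) (Measure.infinitePi fun _ : ℕ => μ) :=
    iIndepFun_infinitePi (X := fun _ x => x) (fun _ => measurable_id)
  have h := (hind.precomp (add_right_injective n)).map_fun_eq_infinitePi_map
    fun i => measurable_pi_apply (n + i)
  simpa only [Function.comp_def, infinitePi_map_eval] using h

variable (G) in
/-- The history of the increments: `initialFiltration G n` is generated by the first `n` ones. -/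
def initialFiltration : Filtration ℕ (inferInstance : MeasurableSpace (ℕ → G)) where
  seq n := MeasurableSpace.comap (fun (ω : ℕ → G) (i : Fin n) => ω i) inferInstance
  mono' n m hnm := by
    have h : Measurable fun (u : Fin m → G) (i : Fin n) => u ⟨i, i.2.trans_le hnm⟩ :=
      measurable_pi_iff.2 fun i => measurable_pi_apply _
    exact Measurable.comap_le (h.comp (comap_measurable fun (ω : ℕ → G) (i : Fin m) => ω i))
  le' n := Measurable.comap_le (measurable_pi_iff.2 fun i => measurable_pi_apply _)

theorem iSup_initialFiltration :
    ⨆ n, initialFiltration G n = (inferInstance : MeasurableSpace (ℕ → G)) := by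
  refine le_antisymm (iSup_le fun n => (initialFiltration G).le n) (iSup_le fun i => ?_)
  have h : Measurable fun u : Fin (i + 1) → G => u ⟨i, i.lt_succ_self⟩ := measurable_pi_apply _
  exact le_iSup_of_le (i + 1)
    (Measurable.comap_le (h.comp (comap_measurable fun (ω : ℕ → G) (j : Fin (i + 1)) => ω j)))

end Increments

section PathLaw

variable {G : Type*} [MeasurableSpace G]

theorem measurable_pathLim {f : G → ℝ} (hf : Measurable f) : Measurable (pathLim f) :=
  Measurable.limsup fun n => hf.comp (measurable_pi_apply n)

variable [Group G] [MeasurableMul₂ G]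

theorem measurable_walk : Measurable fun p : G × (ℕ → G) => walk p.1 p.2 := by
  refine measurable_pi_iff.2 fun n => ?_
  induction n with
  | zero => exact measurable_fst
  | succ n ih => exact ih.mul ((measurable_pi_apply n).comp measurable_snd)

theorem measurable_walk_right (g : G) : Measurable (walk g) :=
  measurable_walk.comp measurable_prodMk_left

theorem measurable_translate (k : G) : Measurable fun (x : ℕ → G) n => k * x n :=
  measurable_pi_iff.2 fun n => (measurable_const_mul k).comp (measurable_pi_apply n)

/-- The position at time `n` is a function of the first `n` increments. -/
theorem exists_walk_eq_comp (g : G) (n : ℕ) : ∃ pos : (Fin n → G) → G, Measurable pos ∧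
    ∀ ω : ℕ → G, pos (fun i => ω i) = walk g ω n := by
  refine ⟨fun u => walk g (fun i => if h : i < n then u ⟨i, h⟩ else 1) n, ?_, fun ω =>
    walk_congr g fun i hi => by simp [hi]⟩
  refine (measurable_pi_apply n).comp ((measurable_walk_right g).comp ?_)
  refine measurable_pi_iff.2 fun i => ?_
  by_cases hi : i < n
  · simpa only [hi, dite_true] using measurable_pi_apply _
  · simpa only [hi, dite_false] using measurable_const

variable (μ : Measure G) [IsProbabilityMeasure μ]

instance isProbabilityMeasure_pathLaw (g : G) : IsProbabilityMeasure (pathLaw μ g) :=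
  isProbabilityMeasure_map (measurable_walk_right g).aemeasurable

theorem map_translate_pathLaw (k g : G) :
    (pathLaw μ g).map (fun x n => k * x n) = pathLaw μ (k * g) := by
  rw [pathLaw, Measure.map_map (measurable_translate k) (measurable_walk_right g), pathLaw]
  congr 1
  funext ω
  exact mul_walk k g ω

variable {μ}

theorem ae_pathLaw_of_ae {g : G} {p : (ℕ → G) → Prop} (hp : MeasurableSet {x | p x})
    (h : ∀ᵐ ω ∂(Measure.infinitePi fun _ : ℕ => μ), p (walk g ω)) : ∀ᵐ x ∂pathLaw μ g, p x :=
  (ae_map_iff (measurable_walk_right g).aemeasurable hp).2 h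

theorem ae_translate {k g : G} {p : (ℕ → G) → Prop} (h : ∀ᵐ x ∂pathLaw μ (k * g), p x) :
    ∀ᵐ x ∂pathLaw μ g, p fun n => k * x n := by
  rw [← map_translate_pathLaw] at h
  exact ae_of_ae_map (measurable_translate k).aemeasurable h

theorem integral_pathLaw_eq (g : G) {Ψ : (ℕ → G) → ℝ} (hΨ : Measurable Ψ) :
    ∫ x, Ψ x ∂pathLaw μ g = ∫ ω, Ψ (walk g ω) ∂(Measure.infinitePi fun _ : ℕ => μ) :=
  integral_map (measurable_walk_right g).aemeasurable hΨ.aestronglyMeasurable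

theorem measurable_integral_pathLaw {Ψ : (ℕ → G) → ℝ} (hΨ : Measurable Ψ) :
    Measurable fun g => ∫ x, Ψ x ∂pathLaw μ g := by
  simp_rw [integral_pathLaw_eq _ hΨ]
  exact (StronglyMeasurable.integral_prod_right (f := fun g ω => Ψ (walk g ω))
    (hΨ.comp measurable_walk).stronglyMeasurable).measurable

theorem abs_integral_le {α : Type*} [MeasurableSpace α] {P : Measure α} [IsProbabilityMeasure P]
    {Ψ : α → ℝ} {C : ℝ} (hC : ∀ x, |Ψ x| ≤ C) : |∫ x, Ψ x ∂P| ≤ C := by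
  rw [← Real.norm_eq_abs]
  simpa using norm_integral_le_of_norm_le_const (μ := P) (f := Ψ) (C := C) (ae_of_all _ hC)

/-- The Markov property. -/
theorem condExp_walk_add {Φ : (ℕ → G) → ℝ} (hΦ : Measurable Φ) {C : ℝ} (hC : ∀ x, |Φ x| ≤ C)
    (g : G) (n : ℕ) :
    (Measure.infinitePi fun _ : ℕ => μ)[fun ω => Φ fun m => walk g ω (n + m) |
        initialFiltration G n] =ᵐ[Measure.infinitePi fun _ : ℕ => μ]
      fun ω => ∫ x, Φ x ∂pathLaw μ (walk g ω n) := by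
  obtain ⟨pos, hposm, hpos_eq⟩ := exists_walk_eq_comp g n
  have h := condExp_comap_of_indepFun (P := Measure.infinitePi fun _ : ℕ => μ)
    (U := fun ω (i : Fin n) => ω i) (V := fun ω i => ω (n + i))
    (Φ := fun p => Φ (walk (pos p.1) p.2))
    (measurable_pi_iff.2 fun i => measurable_pi_apply _)
    (measurable_pi_iff.2 fun i => measurable_pi_apply _) (indepFun_initial_tail μ n)
    (hΦ.comp (measurable_walk.comp ((hposm.comp measurable_fst).prodMk measurable_snd)))
    fun p => hC _
  rw [map_tail] at h
  simp only [hpos_eq, ← walk_add] at h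
  refine h.trans (ae_of_all _ fun ω => ?_)
  exact (integral_map (measurable_walk_right _).aemeasurable hΦ.aestronglyMeasurable).symm

theorem integral_pathLaw_one {f : G → ℝ} (hf : Measurable f) (g : G) :
    ∫ x, f (x 1) ∂pathLaw μ g = ∫ y, f (g * y) ∂μ := by
  have hm : Measurable fun y => f (g * y) := hf.comp (measurable_const_mul g)
  rw [integral_pathLaw_eq g (Ψ := fun x => f (x 1)) (hf.comp (measurable_pi_apply 1))]
  conv_rhs => rw [← infinitePi_map_eval (fun _ : ℕ => μ) 0]
  rw [integral_map (measurable_pi_apply 0).aemeasurable hm.aestronglyMeasurable]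
  rfl

/-- Expectations of shift invariant functions are harmonic functions of the starting point. -/
theorem isHarmonic_integral_pathLaw {Ψ : (ℕ → G) → ℝ} (hΨ : Measurable Ψ) {C : ℝ}
    (hC : ∀ x, |Ψ x| ≤ C) (hinv : ∀ x, Ψ (shift x) = Ψ x) :
    IsHarmonic μ fun g => ∫ x, Ψ x ∂pathLaw μ g := by
  refine ⟨measurable_integral_pathLaw hΨ, ⟨C, fun g => abs_integral_le hC⟩, fun g => ?_⟩
  rw [← integral_pathLaw_one (measurable_integral_pathLaw hΨ),
    integral_pathLaw_eq g (Ψ := fun x => ∫ y, Ψ y ∂pathLaw μ (x 1))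
      ((measurable_integral_pathLaw hΨ).comp (measurable_pi_apply 1)),
    ← integral_congr_ae (condExp_walk_add hΨ hC g 1),
    integral_condExp ((initialFiltration G).le 1), integral_pathLaw_eq g hΨ]
  simp only [apply_tail hinv]

/-- Lévy's zero-one law: the harmonic function given by a shift invariant function converges to it
along almost every path. -/
theorem ae_tendsto_integral_pathLaw {Ψ : (ℕ → G) → ℝ} (hΨ : Measurable Ψ) {C : ℝ}
    (hC : ∀ x, |Ψ x| ≤ C) (hinv : ∀ x, Ψ (shift x) = Ψ x) (g : G) :
    ∀ᵐ x ∂pathLaw μ g, Tendsto (fun n => ∫ y, Ψ y ∂pathLaw μ (x n)) atTop (𝓝 (Ψ x)) := by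
  have hh := measurable_integral_pathLaw (μ := μ) hΨ
  refine ae_pathLaw_of_ae (measurableSet_tendsto_fun
    (fun n => hh.comp (measurable_pi_apply n)) hΨ) ?_
  have hm := hΨ.comp (measurable_walk_right g)
  have hlevy := (integrable_of_measurable_of_bounded (P := Measure.infinitePi fun _ : ℕ => μ) hm
    fun ω => hC _).tendsto_ae_condExp (ℱ := initialFiltration G)
      (by rw [iSup_initialFiltration]; exact hm.stronglyMeasurable)
  have hmarkov := ae_all_iff.2 fun n => condExp_walk_add (μ := μ) hΨ hC g n
  filter_upwards [hlevy, hmarkov] with ω h1 h2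
  simp only [apply_tail hinv] at h2
  simp only [← h2]
  exact h1

namespace IsHarmonic

theorem condExp_walk {f : G → ℝ} (hf : IsHarmonic μ f) (g : G) (n : ℕ) :
    (Measure.infinitePi fun _ : ℕ => μ)[fun ω => f (walk g ω (n + 1)) | initialFiltration G n]
      =ᵐ[Measure.infinitePi fun _ : ℕ => μ] fun ω => f (walk g ω n) := by
  obtain ⟨C, hC⟩ := hf.bounded
  refine (condExp_walk_add (Φ := fun x => f (x 1)) (hf.measurable.comp (measurable_pi_apply 1))
    (fun x => hC _) g n).trans (ae_of_all _ fun ω => ?_)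
  simp only [integral_pathLaw_one hf.measurable, hf.mean]

theorem integral_pathLaw {f : G → ℝ} (hf : IsHarmonic μ f) (g : G) (n : ℕ) :
    ∫ x, f (x n) ∂pathLaw μ g = f g := by
  have hm := fun n => hf.measurable.comp (measurable_pi_apply (X := fun _ : ℕ => G) n)
  have h : ∀ n, ∫ x, f (x n) ∂pathLaw μ g =
      ∫ ω, f (walk g ω n) ∂(Measure.infinitePi fun _ : ℕ => μ) := fun n =>
    integral_pathLaw_eq g (hm n)
  rw [h]
  induction n with
  | zero => simp [walk]
  | succ n ih =>
    rw [← ih, ← integral_congr_ae (hf.condExp_walk g n),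
      integral_condExp ((initialFiltration G).le n)]

/-- Bounded harmonic functions converge along almost every path. -/
theorem ae_tendsto_pathLim {f : G → ℝ} (hf : IsHarmonic μ f) (g : G) :
    ∀ᵐ x ∂pathLaw μ g, Tendsto (fun n => f (x n)) atTop (𝓝 (pathLim f x)) := by
  obtain ⟨C, hC⟩ := hf.bounded
  have hm := fun n => hf.measurable.comp (measurable_pi_apply (X := fun _ : ℕ => G) n)
  refine ae_pathLaw_of_ae (measurableSet_tendsto_fun hm (measurable_pathLim hf.measurable)) ?_
  have hadapt : StronglyAdapted (initialFiltration G) fun n ω => f (walk g ω n) := fun n => by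
    obtain ⟨pos, hposm, hpos_eq⟩ := exists_walk_eq_comp g n
    have heq : (fun ω : ℕ → G => f (walk g ω n)) = (f ∘ pos) ∘ fun ω i => ω i :=
      funext fun ω => congrArg f (hpos_eq ω).symm
    change StronglyMeasurable[initialFiltration G n] fun ω : ℕ → G => f (walk g ω n)
    rw [heq]
    exact ((hf.measurable.comp hposm).comp
      (comap_measurable fun (ω : ℕ → G) (i : Fin n) => ω i)).stronglyMeasurable
  have hmart : Martingale (fun n (ω : ℕ → G) => f (walk g ω n)) (initialFiltration G)
      (Measure.infinitePi fun _ : ℕ => μ) :=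
    martingale_nat hadapt (fun n => integrable_of_measurable_of_bounded
      ((hm n).comp (measurable_walk_right g)) fun ω => hC _)
      fun n => (hf.condExp_walk g n).symm
  have hconv := hmart.submartingale.exists_ae_tendsto_of_bdd (R := C.toNNReal) fun n => by
    refine (eLpNorm_le_of_ae_bound (C := C) (ae_of_all _ fun ω => hC _)).trans ?_
    simp [ENNReal.ofReal]
  filter_upwards [hconv] with ω hω
  obtain ⟨c, hc⟩ := hω
  rw [pathLim, hc.limsup_eq]
  exact hc

theorem integral_pathLim {f : G → ℝ} (hf : IsHarmonic μ f) (g : G) :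
    ∫ x, pathLim f x ∂pathLaw μ g = f g := by
  obtain ⟨C, hC⟩ := hf.bounded
  refine tendsto_nhds_unique (tendsto_integral_of_dominated_convergence (fun _ => C)
    (fun n => (hf.measurable.comp (measurable_pi_apply n)).aestronglyMeasurable)
    (integrable_const C) (fun n => ae_of_all _ fun x => hC _) (hf.ae_tendsto_pathLim g)) ?_
  simp only [Function.comp_apply, hf.integral_pathLaw]
  exact tendsto_const_nhds

end IsHarmonic

end PathLaw

/-! ### Laws of boundary values -/

section

/-- The Cramér–Wold device for arbitrary families of real random variables. -/
theorem map_eq_map_of_forall_sum {α L : Type*} [MeasurableSpace α] {P P' : Measure α}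
    [IsFiniteMeasure P] [IsFiniteMeasure P'] {Y : α → L → ℝ} (hY : Measurable Y)
    (h : ∀ (I : Finset L) (t : I → ℝ),
      P.map (fun a => ∑ i, t i * Y a i) = P'.map fun a => ∑ i, t i * Y a i) :
    P.map Y = P'.map Y := by
  refine IsProjectiveLimit.unique (P := fun I : Finset L => (P.map Y).map I.restrict)
    (fun I => rfl) fun I => ?_
  have hm := Finset.measurable_restrict (X := fun _ : L => ℝ) I
  refine Measure.ext_of_charFunDual (funext fun ℓ => ?_)
  rw [charFunDual_eq_charFun_map_one, charFunDual_eq_charFun_map_one,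
    map_map ℓ.continuous.measurable hm, map_map ℓ.continuous.measurable hm,
    map_map (ℓ.continuous.measurable.comp hm) hY, map_map (ℓ.continuous.measurable.comp hm) hY]
  classical
  have hℓ : (ℓ ∘ I.restrict) ∘ Y = fun a => ∑ i : I, ℓ (Pi.single i 1) * Y a i := by
    funext a
    have h1 : I.restrict (Y a) = ∑ i : I, Y a i • (Pi.single i 1 : I → ℝ) := by
      funext j
      simp [Finset.sum_apply, Pi.single_apply]
    simp only [Function.comp_apply]
    rw [h1, _root_.map_sum]
    simp [mul_comm]
  rw [hℓ, h]

/-- Bounded random variables with the same exponential moments have the same law. -/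
theorem map_eq_map_of_integral_exp_eq {α : Type*} [MeasurableSpace α] {P P' : Measure α}
    [IsProbabilityMeasure P] [IsProbabilityMeasure P'] {Y : α → ℝ} (hY : Measurable Y) {C : ℝ}
    (hC : ∀ a, |Y a| ≤ C)
    (h : ∀ s : ℝ, ∫ a, Real.exp (s * Y a) ∂P = ∫ a, Real.exp (s * Y a) ∂P') :
    P.map Y = P'.map Y := by
  have hexp : integrableExpSet Y P = Set.univ := by
    refine Set.eq_univ_of_forall fun s => ?_
    refine integrable_of_measurable_of_bounded (C := Real.exp (|s| * C))
      (Real.measurable_exp.comp (hY.const_mul s)) fun a => ?_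
    rw [Real.abs_exp, Real.exp_le_exp]
    refine (le_abs_self _).trans ?_
    rw [abs_mul]
    exact mul_le_mul_of_nonneg_left (hC a) (abs_nonneg s)
  refine Measure.ext_of_complexMGF_eq hY.aemeasurable hY.aemeasurable (funext fun z => ?_)
  exact eqOn_complexMGF_of_mgf (funext h) (by simp [hexp])

variable {G : Type*} [Group G] [MeasurableSpace G] [MeasurableMul₂ G]
  {μ μ' : Measure G} [IsProbabilityMeasure μ] [IsProbabilityMeasure μ']

/-- `g ↦ 𝔼_g exp (s lim f(xₙ))` is the least harmonic majorant of the subharmonic function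
`exp (s f)`, so that it depends only on the space of harmonic functions. -/
theorem integral_exp_pathLim_le (hμ : ∀ f, IsHarmonic μ' f → IsHarmonic μ f) {f : G → ℝ}
    (hf : IsHarmonic μ f) (hf' : IsHarmonic μ' f) (s : ℝ) (g : G) :
    ∫ x, Real.exp (s * pathLim f x) ∂pathLaw μ g ≤
      ∫ x, Real.exp (s * pathLim f x) ∂pathLaw μ' g := by
  obtain ⟨C, hC⟩ := hf.bounded
  have hexp : ∀ r : ℝ, |r| ≤ C → |Real.exp (s * r)| ≤ Real.exp (|s| * C) := fun r hr => by
    rw [Real.abs_exp, Real.exp_le_exp]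
    refine (le_abs_self _).trans ?_
    rw [abs_mul]
    exact mul_le_mul_of_nonneg_left hr (abs_nonneg s)
  have hpm := measurable_pathLim hf.measurable
  have hΨ : Measurable fun x => Real.exp (s * pathLim f x) :=
    Real.measurable_exp.comp (hpm.const_mul s)
  set v : G → ℝ := fun g => ∫ x, Real.exp (s * pathLim f x) ∂pathLaw μ' g with hv
  have hvμ : IsHarmonic μ v := hμ v (isHarmonic_integral_pathLaw hΨ
    (fun x => hexp _ (abs_pathLim_le hC x)) fun x => by rw [pathLim_shift])
  have hmaj : ∀ g, Real.exp (s * f g) ≤ v g := fun g => by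
    have := convexOn_exp.map_integral_le (μ := pathLaw μ' g) (f := fun x => s * pathLim f x)
      Real.continuous_exp.continuousOn isClosed_univ (ae_of_all _ fun _ => Set.mem_univ _)
      ((integrable_of_measurable_of_bounded hpm (abs_pathLim_le hC)).const_mul s)
      (integrable_of_measurable_of_bounded hΨ fun x => hexp _ (abs_pathLim_le hC x))
    rwa [integral_const_mul, hf'.integral_pathLim] at this
  obtain ⟨D, hD⟩ := hvμ.bounded
  have hstep : ∀ n, ∫ x, Real.exp (s * f (x n)) ∂pathLaw μ g ≤ v g := fun n => by
    rw [← hvμ.integral_pathLaw g n]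
    refine integral_mono ?_ ?_ fun x => hmaj (x n)
    · exact integrable_of_measurable_of_bounded (Real.measurable_exp.comp
        ((hf.measurable.comp (measurable_pi_apply n)).const_mul s)) fun x => hexp _ (hC _)
    · exact integrable_of_measurable_of_bounded
        (hvμ.measurable.comp (measurable_pi_apply n)) fun x => hD _
  refine le_of_tendsto' (tendsto_integral_of_dominated_convergence
    (fun _ => Real.exp (|s| * C)) (fun n => ?_) (integrable_const _)
    (fun n => ae_of_all _ fun x => hexp _ (hC (x n))) ?_) hstep
  · exact (Real.measurable_exp.comp
      ((hf.measurable.comp (measurable_pi_apply n)).const_mul s)).aestronglyMeasurable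
  · filter_upwards [hf.ae_tendsto_pathLim g] with x hx
    exact (Real.continuous_exp.tendsto _).comp (hx.const_mul s)

/-- The law of the boundary values of a harmonic function depends only on the space of harmonic
functions. -/
theorem map_pathLim_eq (hμ : ∀ f, IsHarmonic μ' f ↔ IsHarmonic μ f) {f : G → ℝ}
    (hf : IsHarmonic μ f) (g : G) :
    (pathLaw μ g).map (pathLim f) = (pathLaw μ' g).map (pathLim f) := by
  obtain ⟨C, hC⟩ := hf.bounded
  have hf' := (hμ f).2 hf
  refine map_eq_map_of_integral_exp_eq (measurable_pathLim hf.measurable) (abs_pathLim_le hC)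
    fun s => le_antisymm ?_ ?_
  · exact integral_exp_pathLim_le (fun f => (hμ f).1) hf hf' s g
  · exact integral_exp_pathLim_le (fun f => (hμ f).2) hf' hf s g

end

/-! ### The boundary space and the coordinates of the boundary map -/

section Space

variable (G : Type*) [TopologicalSpace G] (ι : Type*)

/-- Families of continuous functions on `G` indexed by `ι`, with the compact-open topology and its
Borel σ-algebra. The group acts by translating the argument on the right,
`(g • φ) i k = φ i (k g)`. -/
def BoundarySpace : Type _ := ι → C(G, ℝ)

namespace BoundarySpace

instance : TopologicalSpace (BoundarySpace G ι) := inferInstanceAs (TopologicalSpace (ι → C(G, ℝ)))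

instance : MeasurableSpace (BoundarySpace G ι) := borel _

instance : BorelSpace (BoundarySpace G ι) := ⟨rfl⟩

instance [Countable ι] [LocallyCompactSpace G] [T2Space G] [SecondCountableTopology G] :
    PolishSpace (BoundarySpace G ι) := inferInstanceAs (PolishSpace (ι → C(G, ℝ)))

variable {G ι}

instance [Group G] [ContinuousMul G] : MulAction G (BoundarySpace G ι) where
  smul g φ := fun i => (φ i).comp ⟨fun k => k * g, continuous_mul_const g⟩
  one_smul φ := by
    funext i; ext k
    exact congrArg (φ i) (mul_one k)
  mul_smul g g' φ := by
    funext i; ext k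
    exact congrArg (φ i) (mul_assoc k g g').symm

instance [Group G] [ContinuousMul G] [LocallyCompactSpace G] :
    ContinuousSMul G (BoundarySpace G ι) where
  continuous_smul := by
    refine continuous_pi fun i => ContinuousMap.continuous_of_continuous_uncurry _ ?_
    have h1 : Continuous fun p : (G × BoundarySpace G ι) × G => p.1.2 i :=
      (continuous_apply (A := fun _ : ι => C(G, ℝ)) i).comp (continuous_snd.comp continuous_fst)
    have h2 : Continuous fun p : (G × BoundarySpace G ι) × G => p.2 * p.1.1 := by fun_prop
    exact h1.eval h2

theorem measurable_apply (i : ι) (k : G) : Measurable fun φ : BoundarySpace G ι => φ i k := by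
  refine Continuous.measurable ?_
  exact (continuous_eval_const (F := C(G, ℝ)) k).comp
    (continuous_apply (A := fun _ : ι => C(G, ℝ)) i)

/-- The values at a countable dense set of points of `G`. -/
noncomputable def values [Nonempty G] [TopologicalSpace.SeparableSpace G] (φ : BoundarySpace G ι) :
    ι × ℕ → ℝ := fun p => φ p.1 (TopologicalSpace.denseSeq G p.2)

theorem measurableEmbedding_values [Nonempty G] [Countable ι] [LocallyCompactSpace G] [T2Space G]
    [SecondCountableTopology G] : MeasurableEmbedding (values : BoundarySpace G ι → ι × ℕ → ℝ) := by
  refine Continuous.measurableEmbedding (continuous_pi fun p => ?_) fun φ ψ h => ?_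
  · exact (continuous_eval_const (F := C(G, ℝ)) _).comp
      (continuous_apply (A := fun _ : ι => C(G, ℝ)) p.1)
  · funext i
    refine ContinuousMap.ext fun k => congrFun ?_ k
    refine Continuous.ext_on (TopologicalSpace.denseRange_denseSeq G) (φ i).continuous
      (ψ i).continuous ?_
    rintro _ ⟨n, rfl⟩
    exact congrFun h (i, n)

end BoundarySpace

end Space

section Coordinates

variable {G : Type*} [Group G] [MeasurableSpace G]

/-- The function `k ↦ ∫_C lim f(u⁻¹ k xₙ) dm(u)` attached to a path `x`. -/
noncomputable def boundaryCoord (m : Measure G) (f : G → ℝ) (C : Set G) (x : ℕ → G) (k : G) : ℝ :=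
  ∫ u in C, pathLim f (fun n => u⁻¹ * k * x n) ∂m

theorem boundaryCoord_translate {m : Measure G} (f : G → ℝ) (C : Set G) (x : ℕ → G) (g k : G) :
    boundaryCoord m f C (fun n => g * x n) k = boundaryCoord m f C x (k * g) := by
  simp only [boundaryCoord, mul_assoc]

theorem boundaryCoord_shift {m : Measure G} (f : G → ℝ) (C : Set G) (x : ℕ → G) :
    boundaryCoord m f C (shift x) = boundaryCoord m f C x := by
  funext k
  refine integral_congr_ae (ae_of_all _ fun u => ?_)
  exact pathLim_shift f fun n => u⁻¹ * k * x n

end Coordinates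

section Coordinates

variable {G : Type*} [Group G] [TopologicalSpace G] [IsTopologicalGroup G]
    [LocallyCompactSpace G] [SecondCountableTopology G]
    [MeasurableSpace G] [BorelSpace G] (m : Measure G) [m.IsHaarMeasure]

/-- Averaging a bounded function over left translates makes it continuous, because left
translations act continuously on `L¹`. -/
theorem continuous_setIntegral_inv_mul {ζ : G → ℝ} (hζ : Measurable ζ) {D : ℝ}
    (hD : ∀ g, |ζ g| ≤ D) {C : Set G} (hC : MeasurableSet C) (hmC : m C ≠ ∞) :
    Continuous fun k => ∫ u in C, ζ (u⁻¹ * k) ∂m := by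
  have hζ' : Measurable fun v : G => ζ v⁻¹ := hζ.comp measurable_inv
  have hint : ∀ φ : Lp ℝ 1 m, Integrable (fun v => ζ v⁻¹ * φ v) m := fun φ =>
    (L1.integrable_coeFn φ).bdd_mul hζ'.aestronglyMeasurable (ae_of_all _ fun v => hD _)
  have hT : Continuous fun φ : Lp ℝ 1 m => ∫ v, ζ v⁻¹ * φ v ∂m := by
    refine (LipschitzWith.of_dist_le_mul (K := D.toNNReal) fun φ ψ => ?_).continuous
    have hD0 : 0 ≤ D := (abs_nonneg _).trans (hD 1)
    rw [dist_eq_norm, ← integral_sub (hint φ) (hint ψ), dist_eq_norm, L1.norm_eq_integral_norm,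
      Real.coe_toNNReal _ hD0, ← integral_const_mul]
    refine norm_integral_le_of_norm_le ((L1.integrable_coeFn (φ - ψ)).norm.const_mul D) ?_
    filter_upwards [Lp.coeFn_sub φ ψ] with v hv
    rw [hv, Pi.sub_apply, ← mul_sub, norm_mul]
    exact mul_le_mul_of_nonneg_right (hD _) (norm_nonneg _)
  have : Fact ((1 : ℝ≥0∞) ≠ ∞) := ⟨ENNReal.one_ne_top⟩
  have hact : Continuous fun k : G =>
      (DomMulAct.mk k • indicatorConstLp 1 hC hmC (1 : ℝ) : Lp ℝ 1 m) :=
    (DomMulAct.continuous_mk).smul continuous_const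
  convert hT.comp hact using 1
  funext k
  rw [Function.comp_apply, DomMulAct.mk_smul_indicatorConstLp,
    ← integral_indicator hC, ← integral_mul_left_eq_self _ k]
  -- the substitution `u = k v` turns the integrand into `1_C(k v) ζ(v⁻¹)`
  refine integral_congr_ae ?_
  filter_upwards [indicatorConstLp_coeFn (p := 1) (c := (1 : ℝ))
    (hs := (measurable_const_smul k) hC) (hμs := by
      rw [measure_preimage_smul_of_nullMeasurableSet hC.nullMeasurableSet]; exact hmC)] with v hv
  rw [hv]
  by_cases h : k * v ∈ C
  · simp [Set.indicator, h]
  · simp [Set.indicator, h]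

variable {m}

theorem continuous_boundaryCoord {f : G → ℝ} (hf : Measurable f) (hb : ∃ D, ∀ g, |f g| ≤ D)
    {C : Set G} (hC : MeasurableSet C) (hmC : m C ≠ ∞) (x : ℕ → G) :
    Continuous (boundaryCoord m f C x) := by
  obtain ⟨D, hD⟩ := hb
  refine continuous_setIntegral_inv_mul m (ζ := fun g => pathLim f fun n => g * x n)
    ((measurable_pathLim hf).comp (measurable_pi_iff.2 fun n => measurable_mul_const _))
    (fun g => abs_pathLim_le hD _) hC hmC

theorem measurable_boundaryCoord {f : G → ℝ} (hf : Measurable f) (C : Set G) (k : G) :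
    Measurable fun x => boundaryCoord m f C x k := by
  have h : Measurable fun (p : (ℕ → G) × G) (n : ℕ) => p.2⁻¹ * k * p.1 n := by
    refine measurable_pi_iff.2 fun n => ?_
    have h1 : Measurable fun p : (ℕ → G) × G => p.2⁻¹ * k := measurable_snd.inv.mul_const k
    have h2 : Measurable fun p : (ℕ → G) × G => p.1 n :=
      (measurable_pi_apply n).comp measurable_fst
    exact h1.mul h2
  have hZ : StronglyMeasurable fun p : (ℕ → G) × G => pathLim f fun n => p.2⁻¹ * k * p.1 n :=
    ((measurable_pathLim hf).comp h).stronglyMeasurable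
  exact (hZ.integral_prod_right' (ν := m.restrict C)).measurable

/-- Harmonicity is a condition on right translates, so it is kept by averaging left translates. -/
theorem isHarmonic_setIntegral {μ : Measure G} [IsProbabilityMeasure μ] {f : G → ℝ}
    (hf : IsHarmonic μ f) {C : Set G} (hmC : m C ≠ ∞) (k : G) :
    IsHarmonic μ fun g => ∫ u in C, f (u⁻¹ * k * g) ∂m := by
  obtain ⟨D, hD⟩ := hf.bounded
  have : IsFiniteMeasure (m.restrict C) := ⟨by simpa using hmC.lt_top⟩
  have hm : Measurable fun p : G × G => f (p.2⁻¹ * k * p.1) :=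
    hf.measurable.comp ((measurable_snd.inv.mul_const k).mul measurable_fst)
  refine ⟨(StronglyMeasurable.integral_prod_right (f := fun g u => f (u⁻¹ * k * g))
    hm.stronglyMeasurable).measurable, ⟨D * (m.restrict C).real Set.univ, fun g => ?_⟩, fun g => ?_⟩
  · exact norm_integral_le_of_norm_le_const (f := fun u => f (u⁻¹ * k * g)) (C := D)
      (ae_of_all _ fun u => hD _)
  · rw [integral_integral_swap]
    · refine integral_congr_ae (ae_of_all _ fun u => ?_)
      simpa only [mul_assoc] using hf.mean (u⁻¹ * k * g)
    · have h2 : Measurable fun p : G × G => (g * p.1, p.2) :=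
        (measurable_fst.const_mul g).prodMk measurable_snd
      exact integrable_of_measurable_of_bounded (hm.comp h2) fun p => hD _

/-- The values of `boundaryCoord` are, for almost every path and simultaneously for all `k`, the
boundary values of the harmonic functions `g ↦ ∫_C f(u⁻¹ k g) dm(u)`. -/
theorem ae_tendsto_boundaryCoord {μ : Measure G} [IsProbabilityMeasure μ] {f : G → ℝ}
    (hf : IsHarmonic μ f) {C : Set G} (hmC : m C ≠ ∞) (g : G) :
    ∀ᵐ x ∂pathLaw μ g, ∀ k, Tendsto (fun n => ∫ u in C, f (u⁻¹ * k * x n) ∂m) atTop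
      (𝓝 (boundaryCoord m f C x k)) := by
  obtain ⟨D, hD⟩ := hf.bounded
  have : IsFiniteMeasure (m.restrict C) := ⟨by simpa using hmC.lt_top⟩
  -- for almost every path, `f (w⁻¹ xₙ)` converges for almost every `w`
  have hae : ∀ᵐ x ∂pathLaw μ g, ∀ᵐ w ∂m,
      Tendsto (fun n => f (w⁻¹ * x n)) atTop (𝓝 (pathLim f fun n => w⁻¹ * x n)) := by
    have hmw : ∀ n, Measurable fun p : G × (ℕ → G) => p.1⁻¹ * p.2 n := fun n =>
      measurable_fst.inv.mul ((measurable_pi_apply n).comp measurable_snd)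
    have hms : MeasurableSet {p : G × (ℕ → G) | Tendsto (fun n => f (p.1⁻¹ * p.2 n)) atTop
        (𝓝 (pathLim f fun n => p.1⁻¹ * p.2 n))} :=
      measurableSet_tendsto_fun (fun n => hf.measurable.comp (hmw n))
        ((measurable_pathLim hf.measurable).comp (measurable_pi_iff.2 hmw))
    refine (Measure.ae_ae_comm hms).1 (ae_of_all _ fun w => ?_)
    exact ae_translate (hf.ae_tendsto_pathLim (w⁻¹ * g))
  filter_upwards [hae] with x hx k
  -- left invariance moves the exceptional set
  have hxk : ∀ᵐ u ∂m, Tendsto (fun n => f (u⁻¹ * k * x n)) atTop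
      (𝓝 (pathLim f fun n => u⁻¹ * k * x n)) := by
    have := (measurePreserving_mul_left m k⁻¹).quasiMeasurePreserving.ae hx
    filter_upwards [this] with u hu
    simpa only [mul_inv_rev, inv_inv] using hu
  refine tendsto_integral_of_dominated_convergence (fun _ => D) (fun n => ?_) (integrable_const D)
    (fun n => ae_of_all _ fun u => hD _) (ae_restrict_of_ae hxk)
  exact (hf.measurable.comp
    ((measurable_inv.mul_const k).mul_const (x n))).aestronglyMeasurable

end Coordinates

/-! ### The boundary map and the harmonic measure -/

section HarmonicSum

variable {G : Type*} [Group G] [MeasurableSpace G] [MeasurableMul G] {μ : Measure G}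
  [IsProbabilityMeasure μ]

theorem IsHarmonic.sum_mul {I : Type*} [Fintype I] {f : I → G → ℝ}
    (hf : ∀ i, IsHarmonic μ (f i)) (t : I → ℝ) : IsHarmonic μ fun g => ∑ i, t i * f i g := by
  choose D hD using fun i => (hf i).bounded
  refine ⟨Finset.measurable_sum _ fun i _ => (hf i).measurable.const_mul (t i),
    ⟨∑ i, |t i| * D i, fun g => (Finset.abs_sum_le_sum_abs _ _).trans
      (Finset.sum_le_sum fun i _ => ?_)⟩, fun g => ?_⟩
  · rw [abs_mul]
    exact mul_le_mul_of_nonneg_left (hD i g) (abs_nonneg _)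
  · have hint : ∀ i, Integrable (fun y => f i (g * y)) μ := fun i =>
      integrable_of_measurable_of_bounded ((hf i).measurable.comp (measurable_const_mul g))
        fun y => hD i _
    rw [integral_finsetSum _ fun i _ => (hint i).const_mul (t i)]
    exact Finset.sum_congr rfl fun i _ => by rw [integral_const_mul, (hf i).mean]

end HarmonicSum

section Map

variable {G : Type*} [Group G] [TopologicalSpace G] [MeasurableSpace G] {m : Measure G}
  {ι : Type*} {f : ι → G → ℝ} {C : ι → Set G}

/-- The path `x` is sent to the family of functions `k ↦ ∫_{C i} lim f i (u⁻¹ k xₙ) dm(u)`. This is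
defined for every path and does not refer to the law of the walk. -/
noncomputable def boundaryMap (hc : ∀ i x, Continuous (boundaryCoord m (f i) (C i) x))
    (x : ℕ → G) : BoundarySpace G ι := fun i => ⟨boundaryCoord m (f i) (C i) x, hc i x⟩

variable {hc : ∀ i x, Continuous (boundaryCoord m (f i) (C i) x)}

theorem boundaryMap_shift (x : ℕ → G) : boundaryMap hc (shift x) = boundaryMap hc x := by
  funext i
  exact ContinuousMap.ext fun k => congrFun (boundaryCoord_shift (f i) (C i) x) k

theorem boundaryMap_translate [ContinuousMul G] (k : G) (x : ℕ → G) :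
    boundaryMap hc (fun n => k * x n) = k • boundaryMap hc x := by
  funext i
  exact ContinuousMap.ext fun k' => boundaryCoord_translate (f i) (C i) x k k'

variable [IsTopologicalGroup G] [LocallyCompactSpace G] [SecondCountableTopology G]
  [BorelSpace G] [m.IsHaarMeasure]

theorem measurable_values_boundaryMap (hf : ∀ i, Measurable (f i)) :
    Measurable fun x => (boundaryMap hc x).values :=
  measurable_pi_iff.2 fun p => measurable_boundaryCoord (hf p.1) (C p.1) _

variable [T2Space G] [Countable ι]

theorem measurable_boundaryMap (hf : ∀ i, Measurable (f i)) : Measurable (boundaryMap hc) :=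
  BoundarySpace.measurableEmbedding_values.measurable_comp_iff.1 (measurable_values_boundaryMap hf)

theorem measurable_poissonSigma_boundaryMap (hf : ∀ i, Measurable (f i)) :
    Measurable[poissonSigma G] (boundaryMap hc) := fun B hB =>
  ⟨measurable_boundaryMap hf hB, fun x y h => by
    rw [Set.mem_preimage, Set.mem_preimage, eq_of_pathEquiv boundaryMap_shift h]⟩

/-- The harmonic measure on the boundary depends only on the space of harmonic functions. -/
theorem map_boundaryMap_eq {μ μ' : Measure G} [IsProbabilityMeasure μ] [IsProbabilityMeasure μ']
    (hμ : ∀ f, IsHarmonic μ' f ↔ IsHarmonic μ f) (hf : ∀ i, IsHarmonic μ (f i))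
    (hC : ∀ i, m (C i) ≠ ∞) (g : G) :
    (pathLaw μ g).map (boundaryMap hc) = (pathLaw μ' g).map (boundaryMap hc) := by
  have hfm := fun i => (hf i).measurable
  have hemb := BoundarySpace.measurableEmbedding_values (G := G) (ι := ι)
  suffices h : (pathLaw μ g).map (fun x => (boundaryMap hc x).values) =
      (pathLaw μ' g).map fun x => (boundaryMap hc x).values by
    rw [← hemb.comap_map ((pathLaw μ g).map (boundaryMap hc)),
      ← hemb.comap_map ((pathLaw μ' g).map (boundaryMap hc)),
      map_map hemb.measurable (measurable_boundaryMap hfm),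
      map_map hemb.measurable (measurable_boundaryMap hfm)]
    exact congrArg (Measure.comap _) h
  refine map_eq_map_of_forall_sum (measurable_values_boundaryMap hfm) fun I t => ?_
  -- the linear combination is the boundary value of a harmonic function
  set F : G → ℝ := fun g => ∑ p : I, t p * ∫ u in C p.1.1,
    f p.1.1 (u⁻¹ * TopologicalSpace.denseSeq G p.1.2 * g) ∂m with hF
  have hFh : IsHarmonic μ F :=
    IsHarmonic.sum_mul (fun p : I => isHarmonic_setIntegral (hf p.1.1) (hC p.1.1) _) t
  have hae : ∀ (κ : Measure G) [IsProbabilityMeasure κ], (∀ i, IsHarmonic κ (f i)) →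
      (fun x => ∑ p : I, t p * (boundaryMap hc x).values p) =ᵐ[pathLaw κ g] pathLim F := by
    intro κ _ hκ
    filter_upwards [ae_all_iff.2 fun p : I =>
      ae_tendsto_boundaryCoord (hκ p.1.1) (hC p.1.1) g] with x hx
    exact (tendsto_finsetSum _ fun p _ => (hx p _).const_mul (t p)).limsup_eq.symm
  rw [Measure.map_congr (hae μ hf), Measure.map_congr (hae μ' fun i => (hμ _).2 (hf i)),
    map_pathLim_eq hμ hFh]

end Map

/-! ### Separability and joint measurability -/

/-- Any family of measurable sets contains a sequence from which all its members can be obtained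
as almost sure limits. -/
theorem exists_seq_ae_eventually {X : Type*} [MeasurableSpace X]
    [MeasurableSpace.CountablyGenerated X] (P : Measure X) [IsFiniteMeasure P]
    {p : Set X → Prop} (hp : ∀ A, p A → MeasurableSet A) (hne : ∃ A, p A) :
    ∃ A : ℕ → Set X, (∀ i, p (A i)) ∧ ∀ B, p B → ∃ φ : ℕ → ℕ,
      ∀ᵐ x ∂P, ∀ᶠ j in atTop, (x ∈ A (φ j) ↔ x ∈ B) := by
  have : Fact ((1 : ℝ≥0∞) ≠ ∞) := ⟨ENNReal.one_ne_top⟩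
  set T : {A // p A} → Lp ℝ 1 P := fun A =>
    indicatorConstLp 1 (hp A.1 A.2) (measure_ne_top P A.1) (1 : ℝ) with hT
  have hneT : Nonempty (Set.range T) := by
    obtain ⟨A, hA⟩ := hne
    exact ⟨⟨T ⟨A, hA⟩, ⟨_, rfl⟩⟩⟩
  choose A hA using fun i => (TopologicalSpace.denseSeq (Set.range T) i).2
  refine ⟨fun i => (A i).1, fun i => (A i).2, fun B hB => ?_⟩
  obtain ⟨u, hu, hlim⟩ := mem_closure_iff_seq_limit.1
    (TopologicalSpace.denseRange_denseSeq (Set.range T) (⟨T ⟨B, hB⟩, ⟨_, rfl⟩⟩ : Set.range T))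
  choose ψ hψ using hu
  have hlim' : Tendsto (fun n => T (A (ψ n))) atTop (𝓝 (T ⟨B, hB⟩)) := by
    have := (continuous_subtype_val.tendsto _).comp hlim
    refine this.congr fun n => ?_
    rw [Function.comp_apply, ← hψ n, hA]
  obtain ⟨θ, -, hθ⟩ := (tendstoInMeasure_of_tendsto_Lp hlim').exists_seq_tendsto_ae
  refine ⟨fun j => ψ (θ j), ?_⟩
  have hco : ∀ S : {A // p A}, T S =ᵐ[P] S.1.indicator fun _ => (1 : ℝ) := fun S =>
    indicatorConstLp_coeFn
  filter_upwards [hθ, hco ⟨B, hB⟩, ae_all_iff.2 fun j => hco (A (ψ (θ j)))] with x hx hB' hA'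
  simp only [hB', hA'] at hx
  have hev := (tendsto_order.1 hx)
  by_cases hxB : x ∈ B
  · filter_upwards [hev.1 (1 / 2) (by simp [hxB]; norm_num)] with j hj
    refine iff_of_true ?_ hxB
    by_contra h
    simp [h] at hj
    norm_num at hj
  · filter_upwards [hev.2 (1 / 2) (by simp [hxB])] with j hj
    refine iff_of_false (fun h => ?_) hxB
    simp [h] at hj
    norm_num at hj

/-- A family of functions `Θ a` whose integrals over the sets of a generating π-system depend
measurably on `a` can be modified on null sets so as to be jointly measurable. -/
theorem exists_jointly_measurable {α β : Type*} [MeasurableSpace α] [mβ : MeasurableSpace β]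
    [MeasurableSpace.CountablyGenerated β] (η : Measure β) [IsFiniteMeasure η]
    {S : Set (Set β)} (hS : mβ = MeasurableSpace.generateFrom S) (hπ : IsPiSystem S)
    (huniv : Set.univ ∈ S) {Θ : α → β → ℝ} (hΘ : ∀ a, Measurable (Θ a)) (h0 : ∀ a b, 0 ≤ Θ a b)
    (h1 : ∀ a b, Θ a b ≤ 1) (hint : ∀ s ∈ S, Measurable fun a => ∫ b in s, Θ a b ∂η) :
    ∃ Θ' : α × β → ℝ≥0∞, Measurable Θ' ∧
      ∀ a, ∀ᵐ b ∂η, Θ' (a, b) = ENNReal.ofReal (Θ a b) := by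
  set κ : α → Measure β := fun a => η.withDensity fun b => ENNReal.ofReal (Θ a b) with hκ
  have hle : ∀ a, κ a ≤ η := fun a => by
    conv_rhs => rw [← withDensity_one (μ := η)]
    exact withDensity_mono (ae_of_all _ fun b => ENNReal.ofReal_le_one.2 (h1 a b))
  have hfin : ∀ a, IsFiniteMeasure (κ a) := fun a => isFiniteMeasure_of_le η (hle a)
  have hκs : ∀ s ∈ S, Measurable fun a => κ a s := fun s hs => by
    have hms : MeasurableSet s := hS ▸ MeasurableSpace.measurableSet_generateFrom hs
    have : (fun a => κ a s) = fun a => ENNReal.ofReal (∫ b in s, Θ a b ∂η) := by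
      funext a
      rw [hκ, withDensity_apply _ hms, ofReal_integral_eq_lintegral_ofReal _ (ae_of_all _ (h0 a))]
      exact integrable_of_measurable_of_bounded (hΘ a) fun b =>
        (abs_of_nonneg (h0 a b)).trans_le (h1 a b)
    rw [this]
    exact (hint s hs).ennreal_ofReal
  have hκm : Measurable κ := Measurable.measure_of_isPiSystem hS hπ hκs (hκs _ huniv)
  let K : Kernel α β := ⟨κ, hκm⟩
  have : IsFiniteKernel K := ⟨⟨η Set.univ, measure_lt_top _ _, fun a => hle a _⟩⟩
  refine ⟨fun p => K.rnDeriv (Kernel.const α η) p.1 p.2, Kernel.measurable_rnDeriv _ _,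
    fun a => ?_⟩
  have h2 : K.rnDeriv (Kernel.const α η) a =ᵐ[η] (κ a).rnDeriv η :=
    Kernel.rnDeriv_eq_rnDeriv_measure
  filter_upwards [h2, rnDeriv_withDensity η (hΘ a).ennreal_ofReal] with b hb hb'
  rw [hb, hb']

/-! ### Exhaustion of the Poisson σ-algebra -/

section Indicator

variable {G : Type*}

theorem abs_indicator_le (A : Set (ℕ → G)) (x : ℕ → G) : |(A.indicator 1 x : ℝ)| ≤ 1 := by
  by_cases hx : x ∈ A <;> simp [hx]

theorem indicator_shift [MeasurableSpace G] {A : Set (ℕ → G)}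
    (hA : MeasurableSet[poissonSigma G] A) (x : ℕ → G) :
    (A.indicator 1 (shift x) : ℝ) = A.indicator 1 x := by
  by_cases hx : x ∈ A
  · simp [hx, (hA.2 x _ (pathEquiv_shift x)).1 hx]
  · simp [hx, mt (hA.2 x _ (pathEquiv_shift x)).2 hx]

end Indicator

section Mixed

variable {G : Type*} [Group G] [MeasurableSpace G]

/-- The probability of `A` as a function of the starting point. -/
noncomputable def hitProb (μ : Measure G) [IsProbabilityMeasure μ] (A : Set (ℕ → G)) (g : G) : ℝ :=
  ∫ x, A.indicator 1 x ∂pathLaw μ g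

/-- The mixture `∫ P_g dρ(g)` of the path laws. It is used for a finite measure `ρ` equivalent to
Haar measure. -/
noncomputable def mixedLaw (ρ μ : Measure G) [IsProbabilityMeasure μ] : Measure (ℕ → G) :=
  (ρ.prod (Measure.infinitePi fun _ : ℕ => μ)).map fun p => walk p.1 p.2

theorem hitProb_eq {μ : Measure G} [IsProbabilityMeasure μ] {A : Set (ℕ → G)}
    (hA : MeasurableSet A) (g : G) :
    hitProb μ A g = (pathLaw μ g).real A :=
  integral_indicator_one hA

theorem measurableSet_translate_poissonSigma [MeasurableMul₂ G] {A : Set (ℕ → G)}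
    (hA : MeasurableSet[poissonSigma G] A) (k : G) :
    MeasurableSet[poissonSigma G] {x | (fun n => k * x n) ∈ A} := by
  refine ⟨measurable_translate k hA.1, fun x y hxy => hA.2 _ _ ?_⟩
  obtain ⟨a, b, hab⟩ := hxy
  refine ⟨a, b, funext fun n => ?_⟩
  have := congrFun hab n
  simp only [shift_iterate] at this ⊢
  rw [this]

variable [MeasurableMul₂ G] {μ : Measure G} [IsProbabilityMeasure μ]

theorem hitProb_mem_Icc {A : Set (ℕ → G)} (hA : MeasurableSet A) (g : G) :
    hitProb μ A g ∈ Set.Icc (0 : ℝ) 1 := by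
  rw [hitProb_eq hA]
  exact ⟨measureReal_nonneg, measureReal_le_one⟩

theorem isHarmonic_hitProb {A : Set (ℕ → G)} (hA : MeasurableSet[poissonSigma G] A) :
    IsHarmonic μ (hitProb μ A) :=
  isHarmonic_integral_pathLaw (measurable_one.indicator hA.1) (abs_indicator_le A)
    (indicator_shift hA)

theorem ae_pathLim_hitProb {A : Set (ℕ → G)} (hA : MeasurableSet[poissonSigma G] A) (g : G) :
    ∀ᵐ x ∂pathLaw μ g, pathLim (hitProb μ A) x = A.indicator 1 x := by
  filter_upwards [ae_tendsto_integral_pathLaw (μ := μ) (measurable_one.indicator hA.1)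
    (abs_indicator_le A) (indicator_shift hA) g] with x hx
  exact hx.limsup_eq

instance isFiniteMeasure_mixedLaw (ρ : Measure G) [IsFiniteMeasure ρ] :
    IsFiniteMeasure (mixedLaw ρ μ) := by
  unfold mixedLaw; infer_instance

variable {ρ : Measure G}

theorem ae_mixedLaw_iff {p : (ℕ → G) → Prop} (hp : MeasurableSet {x | p x}) :
    (∀ᵐ x ∂mixedLaw ρ μ, p x) ↔ ∀ᵐ g ∂ρ, ∀ᵐ x ∂pathLaw μ g, p x := by
  rw [mixedLaw, ae_map_iff measurable_walk.aemeasurable hp,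
    Measure.ae_prod_iff_ae_ae (p := fun q : G × (ℕ → G) => p (walk q.1 q.2)) (measurable_walk hp)]
  refine eventually_congr (Eventually.of_forall fun g => ?_)
  rw [pathLaw, ae_map_iff (measurable_walk_right g).aemeasurable hp]

/-- If harmonic functions that vanish almost everywhere vanish, then the starting points of the
walk are immaterial for null sets of the Poisson σ-algebra. -/
theorem ae_pathLaw_of_ae_mixedLaw (hρ : ∀ f, IsHarmonic μ f → f =ᵐ[ρ] 0 → f = 0)
    {E : Set (ℕ → G)} (hE : MeasurableSet[poissonSigma G] E) (h : ∀ᵐ x ∂mixedLaw ρ μ, x ∈ E)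
    (g : G) : ∀ᵐ x ∂pathLaw μ g, x ∈ E := by
  have hEc : MeasurableSet[poissonSigma G] Eᶜ := hE.compl
  have h0 : hitProb μ Eᶜ = 0 := by
    refine hρ _ (isHarmonic_hitProb hEc) ?_
    filter_upwards [(ae_mixedLaw_iff hE.1).1 h] with g hg
    rw [hitProb_eq hEc.1, measureReal_def, show pathLaw μ g Eᶜ = 0 from hg]
    rfl
  have := congrFun h0 g
  rw [hitProb_eq hEc.1, Pi.zero_apply, measureReal_eq_zero_iff] at this
  exact this

/-- The boundary map exhausts the Poisson σ-algebra as soon as it determines a dense sequence of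
its members. -/
theorem exists_preimage_ae_eq_of_dense (hρ : ∀ f, IsHarmonic μ f → f =ᵐ[ρ] 0 → f = 0)
    {Γ : Type*} [MeasurableSpace Γ] {bnd : (ℕ → G) → Γ} (hbnd : Measurable[poissonSigma G] bnd)
    {A : ℕ → Set (ℕ → G)} (hAm : ∀ i, MeasurableSet (A i))
    (hA : ∀ E, MeasurableSet[poissonSigma G] E → ∃ φ : ℕ → ℕ,
      ∀ᵐ x ∂mixedLaw ρ μ, ∀ᶠ j in atTop, (x ∈ A (φ j) ↔ x ∈ E))
    (hB : ∀ i, ∃ B : Set Γ, MeasurableSet B ∧ ∀ g, A i =ᵐ[pathLaw μ g] bnd ⁻¹' B)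
    {E : Set (ℕ → G)} (hE : MeasurableSet[poissonSigma G] E) :
    ∃ B : Set Γ, MeasurableSet B ∧ ∀ g, E =ᵐ[pathLaw μ g] bnd ⁻¹' B := by
  choose B hBm hB using hB
  obtain ⟨φ, hφ⟩ := hA E hE
  set L : Set Γ := liminf (fun j => B (φ j)) atTop with hL
  have hLm : MeasurableSet L := MeasurableSet.measurableSet_liminf fun j => hBm (φ j)
  have hE' : MeasurableSet[poissonSigma G] {x | x ∈ E ↔ x ∈ bnd ⁻¹' L} := hE.iff (hbnd hLm)
  have hBmix : ∀ i, ∀ᵐ x ∂mixedLaw ρ μ, x ∈ A i ↔ x ∈ bnd ⁻¹' B i := fun i =>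
    (ae_mixedLaw_iff ((hAm i).iff (hbnd (hBm i)).1)).2
      (ae_of_all _ fun g => (hB i g).mono fun x hx => iff_of_eq hx)
  have hmix : ∀ᵐ x ∂mixedLaw ρ μ, x ∈ E ↔ x ∈ bnd ⁻¹' L := by
    filter_upwards [hφ, ae_all_iff.2 hBmix] with x h1 h2
    rw [Set.mem_preimage, hL, mem_liminf_iff_eventually_mem]
    refine ⟨fun hx => h1.mono fun j hj => (h2 _).1 (hj.2 hx), fun hx => ?_⟩
    obtain ⟨j, hj, hj'⟩ := (h1.and hx).exists
    exact hj.1 ((h2 _).2 hj')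
  refine ⟨L, hLm, fun g => ?_⟩
  filter_upwards [ae_pathLaw_of_ae_mixedLaw hρ hE' hmix g] with x hx
  exact propext hx

end Mixed

section Exhaustion

variable {G : Type*} [Group G] [TopologicalSpace G] [IsTopologicalGroup G]
  [LocallyCompactSpace G] [T2Space G] [SecondCountableTopology G] [MeasurableSpace G]
  [BorelSpace G] {m : Measure G} [m.IsHaarMeasure] {μ : Measure G} [IsProbabilityMeasure μ]
  {ρ : Measure G} [IsFiniteMeasure ρ] {ι : Type*} [Countable ι] {f : ι → G → ℝ} {C : ι → Set G}
  {hc : ∀ i x, Continuous (boundaryCoord m (f i) (C i) x)}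

/-- If the averages of the translates of `hitProb μ A` over the sets of a π-system `S` generating
the Borel sets of `U` are among the coordinates of the boundary map, then this map determines `A`.
For almost every path `x` these averages determine the function `u ↦ 1_A(u⁻¹ x)` up to a null set
of `U`, hence for almost every `u` they determine whether `u⁻¹ x ∈ A`; the equivariance of the
boundary map then removes the translation by `u⁻¹`. -/
theorem exists_preimage_boundaryMap_ae_eq (hρ : ∀ f, IsHarmonic μ f → f =ᵐ[ρ] 0 → f = 0)
    (hf : ∀ i, Measurable (f i)) {U : Set G} (hU0 : m U ≠ 0) (hU : m U ≠ ∞)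
    {S : Set (Set G)} (hS : ‹MeasurableSpace G› = MeasurableSpace.generateFrom S)
    (hπ : IsPiSystem S) (huniv : Set.univ ∈ S) {A : Set (ℕ → G)}
    (hA : MeasurableSet[poissonSigma G] A)
    (hAS : ∀ s ∈ S, ∃ i, f i = hitProb μ A ∧ C i = s ∩ U) :
    ∃ B : Set (BoundarySpace G ι), MeasurableSet B ∧
      ∀ g, A =ᵐ[pathLaw μ g] boundaryMap hc ⁻¹' B := by
  have hbm : Measurable (boundaryMap hc) := measurable_boundaryMap hf
  set Z := pathLim (hitProb μ A) with hZ
  have hZI : ∀ x, Z x ∈ Set.Icc (0 : ℝ) 1 := pathLim_mem_Icc (hitProb_mem_Icc hA.1)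
  have hZm : Measurable Z := measurable_pathLim (isHarmonic_hitProb hA).measurable
  have hη : IsFiniteMeasure (m.restrict U) := ⟨by simpa using hU.lt_top⟩
  have htr : Measurable fun (p : (ℕ → G) × G) (n : ℕ) => p.2⁻¹ * p.1 n := by
    refine measurable_pi_iff.2 fun n => ?_
    have h1 : Measurable fun p : (ℕ → G) × G => p.2⁻¹ := measurable_snd.inv
    exact h1.mul ((measurable_pi_apply n).comp measurable_fst)
  obtain ⟨Θ, hΘm, hΘ⟩ := @exists_jointly_measurable (ℕ → G) G
    (MeasurableSpace.comap (boundaryMap hc) inferInstance) _ _ (m.restrict U) hη S hS hπ huniv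
    (fun x u => Z fun n => u⁻¹ * x n) (fun x => hZm.comp (htr.comp measurable_prodMk_left))
    (fun x u => (hZI _).1) (fun x u => (hZI _).2) (fun s hs => by
      obtain ⟨i, hfi, hCi⟩ := hAS s hs
      have hsm : MeasurableSet s := hS ▸ MeasurableSpace.measurableSet_generateFrom hs
      have : (fun x : ℕ → G => ∫ u in s, Z (fun n => u⁻¹ * x n) ∂(m.restrict U)) =
          (fun φ : BoundarySpace G ι => φ i 1) ∘ boundaryMap hc := by
        funext x
        rw [Measure.restrict_restrict hsm, ← hCi]
        simp only [hZ, ← hfi]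
        change _ = boundaryCoord m (f i) (C i) x 1
        simp only [boundaryCoord, mul_one]
      rw [this]
      exact (BoundarySpace.measurable_apply i 1).comp (comap_measurable _))
  have hΘm' : Measurable Θ := hΘm.mono
    (sup_le_sup (MeasurableSpace.comap_mono hbm.comap_le) le_rfl) le_rfl
  -- choose `u` such that `Θ (x, u)` is the right value for almost every path
  obtain ⟨u, hu⟩ : ∃ u, ∀ᵐ x ∂mixedLaw ρ μ, Θ (x, u) = ENNReal.ofReal (Z fun n => u⁻¹ * x n) := by
    have hms : MeasurableSet
        {p : (ℕ → G) × G | Θ p = ENNReal.ofReal (Z fun n => p.2⁻¹ * p.1 n)} :=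
      measurableSet_eq_fun hΘm' (hZm.comp htr).ennreal_ofReal
    have hne : NeBot (ae (m.restrict U)) := by
      rw [ae_neBot, Ne, Measure.restrict_eq_zero]; exact hU0
    exact ((Measure.ae_ae_comm (μ := mixedLaw ρ μ) (ν := m.restrict U)
      (p := fun x u => Θ (x, u) = ENNReal.ofReal (Z fun n => u⁻¹ * x n)) hms).1
      (ae_of_all _ hΘ)).exists
  obtain ⟨B, hB, hBΘ⟩ : MeasurableSet[MeasurableSpace.comap (boundaryMap hc) inferInstance]
      {x | Θ (x, u) = 1} :=
    (hΘm.comp (@measurable_prodMk_right _ _ (_) _ u)) (measurableSet_singleton 1)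
  have hAu := measurableSet_translate_poissonSigma hA u⁻¹
  have hBu : MeasurableSet[poissonSigma G] (boundaryMap hc ⁻¹' B) :=
    measurable_poissonSigma_boundaryMap hf hB
  have hE : MeasurableSet[poissonSigma G]
      {x | (fun n => u⁻¹ * x n) ∈ A ↔ x ∈ boundaryMap hc ⁻¹' B} := by
    exact hAu.iff hBu
  have hZA : ∀ᵐ x ∂mixedLaw ρ μ, Z (fun n => u⁻¹ * x n) = A.indicator 1 fun n => u⁻¹ * x n := by
    have htu := measurable_translate u⁻¹
    refine (ae_mixedLaw_iff (measurableSet_eq_fun (hZm.comp htu)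
      ((measurable_one.indicator hA.1).comp htu))).2 (ae_of_all _ fun g => ?_)
    exact ae_translate (ae_pathLim_hitProb hA (u⁻¹ * g))
  have hall := ae_pathLaw_of_ae_mixedLaw hρ hE (by
    filter_upwards [hu, hZA] with x h1 h2
    rw [hBΘ, Set.mem_ofPred_eq, h1, h2]
    by_cases hx : (fun n => u⁻¹ * x n) ∈ A <;> simp [hx])
  refine ⟨{φ | u • φ ∈ B}, (continuous_const_smul u).measurable hB, fun g => ?_⟩
  filter_upwards [ae_translate (hall (u * g))] with x hx
  refine propext ?_
  simp only [inv_mul_cancel_left, Set.mem_preimage, boundaryMap_translate] at hx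
  exact hx

end Exhaustion

/-- Two random walks with the same bounded harmonic functions have the same Poisson boundary, if
harmonic functions are determined by their values almost everywhere. -/
theorem samePoissonBoundary_of_isHarmonic_iff {G : Type*} [Group G] [TopologicalSpace G]
    [IsTopologicalGroup G] [LocallyCompactSpace G] [T2Space G] [SecondCountableTopology G]
    [MeasurableSpace G] [BorelSpace G] {m : Measure G} [m.IsHaarMeasure]
    {μ μ' : Measure G} [IsProbabilityMeasure μ] [IsProbabilityMeasure μ']
    (hμ : ∀ f, IsHarmonic μ' f ↔ IsHarmonic μ f)
    (hm : ∀ f, IsHarmonic μ f → f =ᵐ[m] 0 → f = 0) : SamePoissonBoundary μ μ' := by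
  have hρ : ∀ f, IsHarmonic μ f → f =ᵐ[m.toFinite] 0 → f = 0 := fun f hf h =>
    hm f hf ((absolutelyContinuous_toFinite m).ae_eq h)
  have hρ' : ∀ f, IsHarmonic μ' f → f =ᵐ[m.toFinite] 0 → f = 0 := fun f hf => hρ f ((hμ f).1 hf)
  -- a sequence generating the Poisson σ-algebra modulo null sets, for each of the two walks
  have hmeas : ∀ A : Set (ℕ → G), MeasurableSet[poissonSigma G] A → MeasurableSet A :=
    fun A hA => hA.1
  obtain ⟨A, hA, hAd⟩ := exists_seq_ae_eventually (mixedLaw m.toFinite μ) hmeas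
    ⟨∅, @MeasurableSet.empty _ (poissonSigma G)⟩
  obtain ⟨A', hA', hAd'⟩ := exists_seq_ae_eventually (mixedLaw m.toFinite μ') hmeas
    ⟨∅, @MeasurableSet.empty _ (poissonSigma G)⟩
  -- a countable algebra generating the Borel sets
  set S : Set (Set G) := generateSetAlgebra (MeasurableSpace.countableGeneratingSet G) with hSdef
  have hSalg : IsSetAlgebra S := isSetAlgebra_generateSetAlgebra
  have hS : ‹MeasurableSpace G› = MeasurableSpace.generateFrom S := by
    rw [hSdef, generateFrom_generateSetAlgebra_eq,
      MeasurableSpace.generateFrom_countableGeneratingSet]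
  have hSc : S.Countable :=
    countable_generateSetAlgebra (MeasurableSpace.countable_countableGeneratingSet (α := G))
  have hπ : IsPiSystem S := fun s hs t ht _ => hSalg.inter_mem hs ht
  obtain ⟨c, hcS⟩ := hSc.exists_eq_range ⟨_, hSalg.univ_mem⟩
  have hcm : ∀ j, MeasurableSet (c j) := fun j =>
    hS ▸ MeasurableSpace.measurableSet_generateFrom (hcS ▸ Set.mem_range_self j)
  -- a window of finite positive measure
  obtain ⟨U, hUnhds, hUm⟩ := m.finiteAt_nhds (1 : G)
  obtain ⟨U, hUsub, hUo, hU1⟩ := mem_nhds_iff.1 hUnhds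
  have hU0 : m U ≠ 0 := (hUo.measure_pos m ⟨1, hU1⟩).ne'
  have hUf : m U ≠ ∞ := ((measure_mono hUsub).trans_lt hUm).ne
  let f : (ℕ ⊕ ℕ) × ℕ → G → ℝ := fun i =>
    Sum.elim (fun n => hitProb μ (A n)) (fun n => hitProb μ' (A' n)) i.1
  let C : (ℕ ⊕ ℕ) × ℕ → Set G := fun i => c i.2 ∩ U
  have hf : ∀ i, IsHarmonic μ (f i) := by
    rintro ⟨n | n, j⟩
    · exact isHarmonic_hitProb (hA n)
    · exact (hμ _).1 (isHarmonic_hitProb (hA' n))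
  have hfm : ∀ i, Measurable (f i) := fun i => (hf i).measurable
  have hCf : ∀ i, m (C i) ≠ ∞ := fun i =>
    ((measure_mono Set.inter_subset_right).trans_lt hUf.lt_top).ne
  have hc : ∀ i x, Continuous (boundaryCoord m (f i) (C i) x) := fun i =>
    continuous_boundaryCoord (hfm i) (hf i).bounded ((hcm _).inter hUo.measurableSet) (hCf i)
  have hbnd : Measurable[poissonSigma G] (boundaryMap hc) :=
    measurable_poissonSigma_boundaryMap hfm
  refine ⟨BoundarySpace G ((ℕ ⊕ ℕ) × ℕ), inferInstance, inferInstance, inferInstance,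
    inferInstance, (pathLaw μ 1).map (boundaryMap hc), ⟨boundaryMap hc, hbnd, fun E hE => ?_,
      fun k g => ae_of_all _ fun x => boundaryMap_translate k x, rfl⟩,
    ⟨boundaryMap hc, hbnd, fun E hE => ?_,
      fun k g => ae_of_all _ fun x => boundaryMap_translate k x,
      (map_boundaryMap_eq hμ hf hCf 1).symm⟩⟩
  · refine exists_preimage_ae_eq_of_dense hρ hbnd (fun n => (hA n).1) hAd (fun n => ?_) hE
    refine exists_preimage_boundaryMap_ae_eq hρ hfm hU0 hUf hS hπ hSalg.univ_mem (hA n) ?_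
    rw [hcS]
    rintro _ ⟨j, rfl⟩
    exact ⟨(Sum.inl n, j), rfl, rfl⟩
  · refine exists_preimage_ae_eq_of_dense hρ' hbnd (fun n => (hA' n).1) hAd' (fun n => ?_) hE
    refine exists_preimage_boundaryMap_ae_eq hρ' hfm hU0 hUf hS hπ hSalg.univ_mem (hA' n) ?_
    rw [hcS]
    rintro _ ⟨j, rfl⟩
    exact ⟨(Sum.inr n, j), rfl, rfl⟩

/-- For an absolutely continuous step distribution, a harmonic function that vanishes almost
everywhere has vanishing averages. -/
theorem IsHarmonic.eq_zero_of_ae_eq_zero {G : Type*} [Group G] [MeasurableSpace G]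
    [MeasurableMul G] {m μ : Measure G} [m.IsMulLeftInvariant] (hμ : μ ≪ m) {f : G → ℝ}
    (hf : IsHarmonic μ f) (h : f =ᵐ[m] 0) : f = 0 := by
  funext g
  rw [← hf.mean g]
  refine integral_eq_zero_of_ae (hμ.ae_le ?_)
  exact (measurePreserving_mul_left m g).quasiMeasurePreserving.ae h

end PoissonBoundary


theorem theorem3p5 {G : Type*} [Group G] [TopologicalSpace G] [IsTopologicalGroup G]
    [LocallyCompactSpace G] [T2Space G] [SecondCountableTopology G]
    [MeasurableSpace G] [BorelSpace G]
    (m : Measure G) [m.IsHaarMeasure]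
    (μ : Measure G) [IsProbabilityMeasure μ] (hμ : PoissonBoundary.IsSpreadOut m μ) :
    ∃ (μ' : Measure G) (_ : IsProbabilityMeasure μ'),
      μ' ≪ m ∧
      (∃ C : ℝ≥0, ∀ᵐ g ∂m, μ'.rnDeriv m g ≤ C) ∧
      (Subgroup.closure μ.support = ⊤ → Subgroup.closure μ'.support = ⊤) ∧
      PoissonBoundary.SamePoissonBoundary μ μ' := by
  obtain ⟨μ', hP, hac, hbd, hsupp, hharm⟩ :=
    PoissonBoundary.exists_bounded_density_same_harmonic hμ
  refine ⟨μ', hP, hac, hbd, fun h => ?_, ?_⟩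
  · rw [eq_top_iff, ← h]
    exact (Subgroup.closure_le _).2 hsupp
  · exact PoissonBoundary.samePoissonBoundary_of_isHarmonic_iff (m := m) hharm fun f hf h =>
      PoissonBoundary.IsHarmonic.eq_zero_of_ae_eq_zero hac ((hharm f).2 hf) h
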